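/- **Theorem 3.1.** Let $n\ge 2$ and $m\ge 1$. A complex Lie superalgebra is a $\mathbb{Z}_2$-graded complex vector space $L=L_{\bar 0}\oplus L_{\bar 1}$ with an even bilinear bracket satisfying, for homogeneous $a,b,c$, $[a,b]=-(-1)^{|a||b|}[b,a]$ and $(-1)^{|c||a|}[a,[b,c]]+(-1)^{|a||b|}[b,[c,a]]+(-1)^{|b||c|}[c,[a,b]]=0$. Ideals are graded, isomorphisms are linear bijections preserving the grading and the bracket, and the nilradical is the greatest nilpotent ideal. Let $L^{n,m}$ be the model filiform Lie superalgebra, with even basis $x_1,\dots,x_n$, odd basis $y_1,\dots,y_m$ and only non-zero products $$[x_1,x_i]=-[x_i,x_1]=x_{i+1}\ (2\le i\le n-1),\qquad [x_1,y_j]=-[y_j,x_1]=y_{j+1}\ (1\le j\le m-1).$$ Let $SL^{n,m}$ be the Lie superalgebra with even basis $x_1,\dots,x_n,t_1,t_2,t_3$, odd basis $y_1,\dots,y_m$ and only non-zero products those of $L^{n,m}$ together with $$\begin{array}{ll}[t_1,x_i]=-[x_i,t_1]=i\,x_i\ (1\le i\le n), & [t_1,y_j]=-[y_j,t_1]=j\,y_j\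 (1\le j\le m),\\ {}[t_2,x_i]=-[x_i,t_2]=x_i\ (2\le i\le n), & [t_3,y_j]=-[y_j,t_3]=y_j\ (1\le j\le m).\end{array}$$ Consider the complex solvable Lie superalgebras $L$ such that $L^2=[L,L]$ is nilpotent and $L$ has a nilradical $N$, isomorphic to $L^{n,m}$. Then: 1. $SL^{n,m}$ is such a Lie superalgebra, and its nilradical has codimension $3$; 2. for every such $L$, $\dim (L/N)\le 3$, so that $3$ is the maximal codimension of the nilradical; 3. every such $L$ of maximal dimension, that is, with $\dim(L/N)=3$, is isomorphic to $SL^{n,m}$. -/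

import Mathlib

/-- A complex Lie superalgebra with underlying vector space `V = V₀ ⊕ V₁`. -/
structure LieSuperalgebra (V : Type*) [AddCommGroup V] [Module ℂ V] where
  /-- the homogeneous components `V₀` (even) and `V₁` (odd) -/
  part : ZMod 2 → Submodule ℂ V
  isCompl : IsCompl (part 0) (part 1)
  bracket : V →ₗ[ℂ] V →ₗ[ℂ] V
  bracket_mem : ∀ i j : ZMod 2, ∀ a ∈ part i, ∀ b ∈ part j, bracket a b ∈ part (i + j)
  skew : ∀ i j : ZMod 2, ∀ a ∈ part i, ∀ b ∈ part j,
    bracket a b = -((-1 : ℂ) ^ (i.val * j.val) • bracket b a)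
  jacobi : ∀ i j k : ZMod 2, ∀ a ∈ part i, ∀ b ∈ part j, ∀ c ∈ part k,
    (-1 : ℂ) ^ (k.val * i.val) • bracket a (bracket b c)
      + (-1 : ℂ) ^ (i.val * j.val) • bracket b (bracket c a)
      + (-1 : ℂ) ^ (j.val * k.val) • bracket c (bracket a b) = 0

namespace LieSuperalgebra

section General

variable {V : Type*} [AddCommGroup V] [Module ℂ V] (G : LieSuperalgebra V)

/-- `[S, T]`: the linear span of all brackets `[s, t]` with `s ∈ S` and `t ∈ T`. -/
def commutator (S T : Submodule ℂ V) : Submodule ℂ V := Submodule.map₂ G.bracket S T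

/-- The descending central sequence of a subalgebra `S`, regarded as an algebra of its own:
`C⁰ = S`, `Cᵏ⁺¹ = [Cᵏ, S]`. -/
def descendingCentral (S : Submodule ℂ V) : ℕ → Submodule ℂ V
  | 0 => S
  | k + 1 => G.commutator (descendingCentral S k) S

/-- The subalgebra `S` is a nilpotent Lie superalgebra. -/
def IsNilpotent (S : Submodule ℂ V) : Prop := ∃ k, G.descendingCentral S k = ⊥

/-- The derived sequence `D⁰ = V`, `Dᵏ⁺¹ = [Dᵏ, Dᵏ]`. -/
def derivedSequence : ℕ → Submodule ℂ V
  | 0 => ⊤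
  | k + 1 => G.commutator (derivedSequence k) (derivedSequence k)

def IsSolvable : Prop := ∃ k, G.derivedSequence k = ⊥

/-- The square `L² = [L, L]`. -/
def square : Submodule ℂ V := G.commutator ⊤ ⊤

/-- A (graded) ideal: a subspace spanned by its homogeneous elements and absorbing brackets.
By super skew-symmetry such a subspace absorbs brackets on both sides. -/
structure IsIdeal (S : Submodule ℂ V) : Prop where
  graded : S ≤ (S ⊓ G.part 0) ⊔ (S ⊓ G.part 1)
  bracket_mem : ∀ a : V, ∀ s ∈ S, G.bracket a s ∈ S

/-- `N` is the nilradical: the greatest nilpotent ideal. -/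
structure IsNilradical (N : Submodule ℂ V) : Prop where
  isIdeal : G.IsIdeal N
  isNilpotent : G.IsNilpotent N
  le_of_isNilpotent : ∀ I : Submodule ℂ V, G.IsIdeal I → G.IsNilpotent I → I ≤ N

/-- An ideal as a Lie superalgebra, with the restricted grading and bracket. -/
def restrict (S : Submodule ℂ V) (hS : G.IsIdeal S) : LieSuperalgebra S where
  part i := (G.part i).comap S.subtype
  isCompl := by
    constructor
    · rw [Submodule.disjoint_def]
      intro a h0 h1
      exact Subtype.ext (Submodule.disjoint_def.1 G.isCompl.disjoint _ h0 h1)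
    · rw [codisjoint_iff, eq_top_iff]
      rintro ⟨a, ha⟩ -
      obtain ⟨b, hb, c, hc, h⟩ := Submodule.mem_sup.1 (hS.graded ha)
      exact Submodule.mem_sup.2 ⟨⟨b, hb.1⟩, hb.2, ⟨c, hc.1⟩, hc.2, Subtype.ext h⟩
  bracket := LinearMap.mk₂ ℂ (fun a b : S => (⟨G.bracket a b, hS.bracket_mem a b b.2⟩ : S))
    (fun _ _ _ => Subtype.ext (by simp)) (fun _ _ _ => Subtype.ext (by simp))
    (fun _ _ _ => Subtype.ext (by simp)) (fun _ _ _ => Subtype.ext (by simp))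
  bracket_mem i j a ha b hb := G.bracket_mem i j a ha b hb
  skew i j a ha b hb := Subtype.ext (G.skew i j a ha b hb)
  jacobi i j k a ha b hb c hc := Subtype.ext (G.jacobi i j k a ha b hb c hc)

/-- Isomorphism of Lie superalgebras: a linear bijection compatible with the grading and with
the bracket. -/
def IsIsomorphic {W : Type*} [AddCommGroup W] [Module ℂ W]
    (G : LieSuperalgebra V) (H : LieSuperalgebra W) : Prop :=
  ∃ e : V ≃ₗ[ℂ] W, (∀ i, (G.part i).map (e : V →ₗ[ℂ] W) = H.part i) ∧
    ∀ a b, e (G.bracket a b) = H.bracket (e a) (e b)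

end General

section Table

variable {ι : Type*}

/-- The span of the basis vectors of parity `i`. -/
noncomputable def tablePart (p : ι → ZMod 2) (i : ZMod 2) : Submodule ℂ (ι →₀ ℂ) :=
  Finsupp.supported ℂ ℂ {s | p s = i}

/-- The bilinear product whose value on the basis vectors `s`, `t` is `c s t`. -/
noncomputable def tableBracket (c : ι → ι → ι →₀ ℂ) :
    (ι →₀ ℂ) →ₗ[ℂ] (ι →₀ ℂ) →ₗ[ℂ] (ι →₀ ℂ) :=
  Finsupp.linearCombination ℂ fun s => Finsupp.linearCombination ℂ (c s)

theorem tableBracket_single (c : ι → ι → ι →₀ ℂ) (s t : ι) :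
    tableBracket c (Finsupp.single s 1) (Finsupp.single t 1) = c s t := by
  simp [tableBracket]

theorem tablePart_induction {p : ι → ZMod 2} {i : ZMod 2} {P : (ι →₀ ℂ) → Prop}
    (h0 : P 0) (ha : ∀ a b, P a → P b → P (a + b)) (hs : ∀ (r : ℂ) a, P a → P (r • a))
    (hb : ∀ s, p s = i → P (Finsupp.single s 1)) : ∀ a ∈ tablePart p i, P a := by
  intro a h
  rw [tablePart, Finsupp.supported_eq_span_single] at h
  induction h using Submodule.span_induction with
  | mem x hx => obtain ⟨s, hs', rfl⟩ := hx; exact hb s hs'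
  | zero => exact h0
  | add x y _ _ hx hy => exact ha x y hx hy
  | smul r x _ hx => exact hs r x hx

/-- The Lie superalgebra with homogeneous basis `ι`, parities `p` and multiplication table `c`. -/
noncomputable def ofTable (p : ι → ZMod 2) (c : ι → ι → ι →₀ ℂ)
    (mem : ∀ s t, c s t ∈ tablePart p (p s + p t))
    (skew : ∀ s t, c s t = -((-1 : ℂ) ^ ((p s).val * (p t).val) • c t s))
    (jacobi : ∀ s t u,
      (-1 : ℂ) ^ ((p u).val * (p s).val) • tableBracket c (Finsupp.single s 1) (c t u)
        + (-1 : ℂ) ^ ((p s).val * (p t).val) • tableBracket c (Finsupp.single t 1) (c u s)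
        + (-1 : ℂ) ^ ((p t).val * (p u).val) • tableBracket c (Finsupp.single u 1) (c s t)
          = 0) :
    LieSuperalgebra (ι →₀ ℂ) where
  part := tablePart p
  isCompl := by
    constructor
    · apply Finsupp.disjoint_supported_supported
      rw [Set.disjoint_left]
      intro s h h'
      exact zero_ne_one (h.symm.trans h')
    · apply Finsupp.codisjoint_supported_supported
      rw [codisjoint_iff, eq_top_iff]
      intro s _
      have : ∀ z : ZMod 2, z = 0 ∨ z = 1 := by decide
      exact this (p s)
  bracket := tableBracket c
  bracket_mem i j := by
    refine tablePart_induction (by simp) (fun a b h h' d hd => ?_) (fun r a h d hd => ?_) ?_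
    · simpa using add_mem (h d hd) (h' d hd)
    · simpa using Submodule.smul_mem _ r (h d hd)
    · intro s hs
      refine tablePart_induction (by simp) (fun a b h h' => ?_) (fun r a h => ?_) ?_
      · simpa using add_mem h h'
      · simpa using Submodule.smul_mem _ r h
      · intro t ht
        rw [tableBracket_single, ← hs, ← ht]
        exact mem s t
  skew i j := by
    refine tablePart_induction (by simp) (fun a b h h' d hd => ?_) (fun r a h d hd => ?_) ?_
    · simp only [map_add, LinearMap.add_apply, h d hd, h' d hd]; module
    · simp only [map_smul, LinearMap.smul_apply, h d hd]; module
    · intro s hs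
      refine tablePart_induction (by simp) (fun a b h h' => ?_) (fun r a h => ?_) ?_
      · simp only [map_add, LinearMap.add_apply, h, h']; module
      · simp only [map_smul, LinearMap.smul_apply, h]; module
      · intro t ht
        rw [tableBracket_single, tableBracket_single, ← hs, ← ht]
        exact skew s t
  jacobi i j k := by
    refine tablePart_induction (by simp) (fun a b h h' d hd f hf => ?_)
      (fun r a h d hd f hf => ?_) ?_
    · have h1 := h d hd f hf
      have h2 := h' d hd f hf
      have h3 := congrArg₂ (· + ·) h1 h2
      simp only [add_zero] at h3
      rw [← h3]
      simp only [map_add, LinearMap.add_apply]; module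
    · have h3 := congrArg (r • ·) (h d hd f hf)
      simp only [smul_zero] at h3
      rw [← h3]
      simp only [map_smul, LinearMap.smul_apply]; module
    intro s hs
    refine tablePart_induction (by simp) (fun a b h h' f hf => ?_) (fun r a h f hf => ?_) ?_
    · have h3 := congrArg₂ (· + ·) (h f hf) (h' f hf)
      simp only [add_zero] at h3
      rw [← h3]
      simp only [map_add, LinearMap.add_apply]; module
    · have h3 := congrArg (r • ·) (h f hf)
      simp only [smul_zero] at h3
      rw [← h3]
      simp only [map_smul, LinearMap.smul_apply]; module
    intro t ht
    refine tablePart_induction (by simp) (fun a b h h' => ?_) (fun r a h => ?_) ?_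
    · have h3 := congrArg₂ (· + ·) h h'
      simp only [add_zero] at h3
      rw [← h3]
      simp only [map_add, LinearMap.add_apply]; module
    · have h3 := congrArg (r • ·) h
      simp only [smul_zero] at h3
      rw [← h3]
      simp only [map_smul, LinearMap.smul_apply]; module
    intro u hu
    rw [tableBracket_single, tableBracket_single, tableBracket_single, ← hs, ← ht, ← hu]
    exact jacobi s t u

end Table

/-- Basis labels of the model filiform superalgebra. Labels start at `0`: `x i` stands for
the basis vector usually written `x_{i+1}`, and `y j` for `y_{j+1}`. -/
inductive FiliformIndex (n m : ℕ) : Type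
  | x (i : Fin n)
  | y (j : Fin m)

namespace FiliformIndex

variable {n m : ℕ}

def parity : FiliformIndex n m → ZMod 2
  | x _ => 0
  | y _ => 1

/-- The basis vector `x k`, or `0` if `k` is out of range. -/
noncomputable def xVec (n m k : ℕ) : FiliformIndex n m →₀ ℂ :=
  if h : k < n then Finsupp.single (x ⟨k, h⟩) 1 else 0

/-- The basis vector `y k`, or `0` if `k` is out of range. -/
noncomputable def yVec (n m k : ℕ) : FiliformIndex n m →₀ ℂ :=
  if h : k < m then Finsupp.single (y ⟨k, h⟩) 1 else 0

/-- The only non-zero products are `[x₁, xᵢ] = -[xᵢ, x₁] = xᵢ₊₁` for `2 ≤ i ≤ n - 1` and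
`[x₁, yⱼ] = -[yⱼ, x₁] = yⱼ₊₁` for `1 ≤ j ≤ m - 1`. -/
noncomputable def table : FiliformIndex n m → FiliformIndex n m → FiliformIndex n m →₀ ℂ
  | x i, x j =>
    if i.val = 0 ∧ j.val ≠ 0 then xVec n m (j + 1)
    else if j.val = 0 ∧ i.val ≠ 0 then -xVec n m (i + 1) else 0
  | x i, y j => if i.val = 0 then yVec n m (j + 1) else 0
  | y j, x i => if i.val = 0 then -yVec n m (j + 1) else 0
  | y _, y _ => 0

theorem xVec_mem (k : ℕ) : xVec n m k ∈ tablePart parity 0 := by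
  unfold xVec
  split_ifs
  · exact Finsupp.single_mem_supported _ _ rfl
  · exact zero_mem _

theorem yVec_mem (k : ℕ) : yVec n m k ∈ tablePart parity 1 := by
  unfold yVec
  split_ifs
  · exact Finsupp.single_mem_supported _ _ rfl
  · exact zero_mem _

theorem bracket_x_x (i : Fin n) (k : ℕ) :
    tableBracket table (Finsupp.single (x i) 1) (xVec n m (k + 1))
      = if i.val = 0 then xVec n m (k + 2) else 0 := by
  by_cases h : k + 1 < n
  · rw [xVec, dif_pos h, tableBracket_single]
    simp [table]
  · have h' : ¬ k + 2 < n := by omega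
    simp [xVec, h, h']

theorem bracket_x_y (i : Fin n) (k : ℕ) :
    tableBracket table (Finsupp.single (x i) 1) (yVec n m (k + 1))
      = if i.val = 0 then yVec n m (k + 2) else 0 := by
  by_cases h : k + 1 < m
  · rw [yVec, dif_pos h, tableBracket_single]
    simp [table]
  · have h' : ¬ k + 2 < m := by omega
    simp [yVec, h, h']

theorem bracket_y_x (j : Fin m) (k : ℕ) :
    tableBracket table (Finsupp.single (y j) 1) (xVec n m (k + 1)) = 0 := by
  by_cases h : k + 1 < n
  · rw [xVec, dif_pos h, tableBracket_single]
    simp [table]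
  · simp [xVec, h]

theorem bracket_y_y (j : Fin m) (k : ℕ) :
    tableBracket table (Finsupp.single (y j) 1) (yVec n m k) = 0 := by
  by_cases h : k < m
  · rw [yVec, dif_pos h, tableBracket_single]
    simp [table]
  · simp [yVec, h]

theorem table_mem (s t : FiliformIndex n m) :
    table s t ∈ tablePart parity (parity s + parity t) := by
  have h2 : (1 : ZMod 2) + 1 = 0 := rfl
  rcases s with i | i <;> rcases t with j | j <;> simp only [table, parity, add_zero, zero_add]
  all_goals (try split_ifs)
  all_goals first
    | exact zero_mem _
    | exact xVec_mem _
    | exact yVec_mem _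
    | exact neg_mem (xVec_mem _)
    | exact neg_mem (yVec_mem _)

theorem table_skew (s t : FiliformIndex n m) :
    table s t = -((-1 : ℂ) ^ ((parity s).val * (parity t).val) • table t s) := by
  rcases s with i | i <;> rcases t with j | j <;> simp [table, parity, ZMod.val_one]
  all_goals split_ifs
  all_goals first
    | omega
    | simp

theorem table_jacobi (s t u : FiliformIndex n m) :
    (-1 : ℂ) ^ ((parity u).val * (parity s).val) • tableBracket table (Finsupp.single s 1) (table t u)
      + (-1 : ℂ) ^ ((parity s).val * (parity t).val) •
          tableBracket table (Finsupp.single t 1) (table u s)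
      + (-1 : ℂ) ^ ((parity t).val * (parity u).val) •
          tableBracket table (Finsupp.single u 1) (table s t) = 0 := by
  have a0 (v w : FiliformIndex n m →₀ ℂ) (p : Prop) [Decidable p] (z : FiliformIndex n m) :
      tableBracket table (Finsupp.single z 1) (if p then v else w) =
        if p then tableBracket table (Finsupp.single z 1) v
        else tableBracket table (Finsupp.single z 1) w := by split_ifs <;> rfl
  rcases s with i | i <;> rcases t with j | j <;> rcases u with k | k <;>
    simp only [table, parity, ZMod.val_one, ZMod.val_zero, a0, map_neg, map_zero, bracket_x_x,
      bracket_x_y, bracket_y_x, bracket_y_y]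
  all_goals (try split_ifs)
  all_goals first
    | omega
    | simp [*]

end FiliformIndex

/-- The model filiform Lie superalgebra `L^{n,m}`. -/
noncomputable def modelFiliform (n m : ℕ) : LieSuperalgebra (FiliformIndex n m →₀ ℂ) :=
  ofTable FiliformIndex.parity FiliformIndex.table FiliformIndex.table_mem
    FiliformIndex.table_skew FiliformIndex.table_jacobi

/-- Basis labels of `SL^{n,m}`. Labels start at `0`: `x i`, `t k`, `y j` stand for the basis
vectors usually written `x_{i+1}`, `t_{k+1}`, `y_{j+1}`. -/
inductive SolvableIndex (n m : ℕ) : Type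
  | x (i : Fin n)
  | t (k : Fin 3)
  | y (j : Fin m)

namespace SolvableIndex

variable {n m : ℕ}

def parity : SolvableIndex n m → ZMod 2
  | x _ => 0
  | t _ => 0
  | y _ => 1

/-- The basis vector `x k`, or `0` if `k` is out of range. -/
noncomputable def xVec (n m k : ℕ) : SolvableIndex n m →₀ ℂ :=
  if h : k < n then Finsupp.single (x ⟨k, h⟩) 1 else 0

/-- The basis vector `y k`, or `0` if `k` is out of range. -/
noncomputable def yVec (n m k : ℕ) : SolvableIndex n m →₀ ℂ :=
  if h : k < m then Finsupp.single (y ⟨k, h⟩) 1 else 0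

/-- The eigenvalue of `ad (t k)` on the basis vector `x i`:
`[t₁, xᵢ] = i xᵢ` for `1 ≤ i ≤ n`, `[t₂, xᵢ] = xᵢ` for `2 ≤ i ≤ n`. -/
def xWeight (k : Fin 3) (i : ℕ) : ℂ := ![(i : ℂ) + 1, if i = 0 then 0 else 1, 0] k

/-- The eigenvalue of `ad (t k)` on the basis vector `y j`:
`[t₁, yⱼ] = j yⱼ` and `[t₃, yⱼ] = yⱼ` for `1 ≤ j ≤ m`. -/
def yWeight (k : Fin 3) (j : ℕ) : ℂ := ![(j : ℂ) + 1, 0, 1] k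

/-- The products of `L^{n,m}`, together with `[t, v] = -[v, t] = (weight of v) v` for
`t = t₁, t₂, t₃` and `v = xᵢ, yⱼ`; all other products are zero. -/
noncomputable def table : SolvableIndex n m → SolvableIndex n m → SolvableIndex n m →₀ ℂ
  | x i, x j =>
    if i.val = 0 ∧ j.val ≠ 0 then xVec n m (j + 1)
    else if j.val = 0 ∧ i.val ≠ 0 then -xVec n m (i + 1) else 0
  | x i, y j => if i.val = 0 then yVec n m (j + 1) else 0
  | y j, x i => if i.val = 0 then -yVec n m (j + 1) else 0
  | t k, x i => xWeight k i • xVec n m i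
  | x i, t k => -(xWeight k i • xVec n m i)
  | t k, y j => yWeight k j • yVec n m j
  | y j, t k => -(yWeight k j • yVec n m j)
  | t _, t _ => 0
  | y _, y _ => 0

theorem xVec_mem (k : ℕ) : xVec n m k ∈ tablePart parity 0 := by
  unfold xVec
  split_ifs
  · exact Finsupp.single_mem_supported _ _ rfl
  · exact zero_mem _

theorem yVec_mem (k : ℕ) : yVec n m k ∈ tablePart parity 1 := by
  unfold yVec
  split_ifs
  · exact Finsupp.single_mem_supported _ _ rfl
  · exact zero_mem _

theorem bracket_x_xVec (i j : Fin n) :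
    tableBracket table (Finsupp.single (x i) 1) (xVec n m j)
      = if i.val = 0 ∧ j.val ≠ 0 then xVec n m (j + 1)
        else if j.val = 0 ∧ i.val ≠ 0 then -xVec n m (i + 1) else 0 := by
  rw [xVec, dif_pos j.2, tableBracket_single]
  simp [table]

theorem bracket_x_yVec (i : Fin n) (j : Fin m) :
    tableBracket table (Finsupp.single (x i) 1) (yVec n m j)
      = if i.val = 0 then yVec n m (j + 1) else 0 := by
  rw [yVec, dif_pos j.2, tableBracket_single]
  simp [table]

theorem bracket_y_xVec (i : Fin n) (j : Fin m) :
    tableBracket table (Finsupp.single (y j) 1) (xVec n m i)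
      = if i.val = 0 then -yVec n m (j + 1) else 0 := by
  rw [xVec, dif_pos i.2, tableBracket_single]
  simp [table]

theorem bracket_x_x (i : Fin n) (k : ℕ) :
    tableBracket table (Finsupp.single (x i) 1) (xVec n m (k + 1))
      = if i.val = 0 then xVec n m (k + 2) else 0 := by
  by_cases h : k + 1 < n
  · rw [xVec, dif_pos h, tableBracket_single]
    simp [table]
  · have h' : ¬ k + 2 < n := by omega
    simp [xVec, h, h']

theorem bracket_x_y (i : Fin n) (k : ℕ) :
    tableBracket table (Finsupp.single (x i) 1) (yVec n m (k + 1))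
      = if i.val = 0 then yVec n m (k + 2) else 0 := by
  by_cases h : k + 1 < m
  · rw [yVec, dif_pos h, tableBracket_single]
    simp [table]
  · have h' : ¬ k + 2 < m := by omega
    simp [yVec, h, h']

theorem bracket_y_x (j : Fin m) (k : ℕ) :
    tableBracket table (Finsupp.single (y j) 1) (xVec n m (k + 1)) = 0 := by
  by_cases h : k + 1 < n
  · rw [xVec, dif_pos h, tableBracket_single]
    simp [table]
  · simp [xVec, h]

theorem bracket_y_y (j : Fin m) (k : ℕ) :
    tableBracket table (Finsupp.single (y j) 1) (yVec n m k) = 0 := by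
  by_cases h : k < m
  · rw [yVec, dif_pos h, tableBracket_single]
    simp [table]
  · simp [yVec, h]

theorem bracket_t_x (l : Fin 3) (k : ℕ) :
    tableBracket table (Finsupp.single (t l) 1) (xVec n m k) = xWeight l k • xVec n m k := by
  by_cases h : k < n
  · have h' : xVec n m k = Finsupp.single (x ⟨k, h⟩) 1 := by rw [xVec, dif_pos h]
    rw [h', tableBracket_single]
    simp [table, h']
  · simp [xVec, h]

theorem bracket_t_y (l : Fin 3) (k : ℕ) :
    tableBracket table (Finsupp.single (t l) 1) (yVec n m k) = yWeight l k • yVec n m k := by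
  by_cases h : k < m
  · have h' : yVec n m k = Finsupp.single (y ⟨k, h⟩) 1 := by rw [yVec, dif_pos h]
    rw [h', tableBracket_single]
    simp [table, h']
  · simp [yVec, h]

theorem xWeight_succ (l : Fin 3) (k : ℕ) (hk : k ≠ 0) :
    xWeight l (k + 1) = xWeight l 0 + xWeight l k := by
  fin_cases l <;> simp [xWeight, hk]; ring

theorem yWeight_succ (l : Fin 3) (k : ℕ) :
    yWeight l (k + 1) = xWeight l 0 + yWeight l k := by
  fin_cases l <;> simp [xWeight, yWeight]; ring

theorem table_mem (s t : SolvableIndex n m) :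
    table s t ∈ tablePart parity (parity s + parity t) := by
  rcases s with i | i | i <;> rcases t with j | j | j
  · change (if _ then _ else _) ∈ tablePart (parity (n := n) (m := m)) 0
    split_ifs
    exacts [xVec_mem _, neg_mem (xVec_mem _), zero_mem _]
  · exact neg_mem (Submodule.smul_mem _ _ (xVec_mem i))
  · change (if _ then _ else _) ∈ tablePart (parity (n := n) (m := m)) 1
    split_ifs
    exacts [yVec_mem _, zero_mem _]
  · exact Submodule.smul_mem _ _ (xVec_mem j)
  · exact zero_mem _
  · exact Submodule.smul_mem _ _ (yVec_mem j)
  · change (if _ then _ else _) ∈ tablePart (parity (n := n) (m := m)) 1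
    split_ifs
    exacts [neg_mem (yVec_mem _), zero_mem _]
  · exact neg_mem (Submodule.smul_mem _ _ (yVec_mem i))
  · exact zero_mem _

theorem table_skew (s t : SolvableIndex n m) :
    table s t = -((-1 : ℂ) ^ ((parity s).val * (parity t).val) • table t s) := by
  rcases s with i | i | i <;> rcases t with j | j | j <;> simp [table, parity, ZMod.val_one]
  all_goals split_ifs
  all_goals first
    | omega
    | simp

theorem table_jacobi (s t u : SolvableIndex n m) :
    (-1 : ℂ) ^ ((parity u).val * (parity s).val) • tableBracket table (Finsupp.single s 1) (table t u)
      + (-1 : ℂ) ^ ((parity s).val * (parity t).val) •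
          tableBracket table (Finsupp.single t 1) (table u s)
      + (-1 : ℂ) ^ ((parity t).val * (parity u).val) •
          tableBracket table (Finsupp.single u 1) (table s t) = 0 := by
  have a0 (v w : SolvableIndex n m →₀ ℂ) (p : Prop) [Decidable p] (z : SolvableIndex n m) :
      tableBracket table (Finsupp.single z 1) (if p then v else w) =
        if p then tableBracket table (Finsupp.single z 1) v
        else tableBracket table (Finsupp.single z 1) w := by split_ifs <;> rfl
  rcases s with i | i | i <;> rcases t with j | j | j <;> rcases u with k | k | k <;>
    simp only [table, parity, ZMod.val_one, ZMod.val_zero, a0, map_neg, map_zero, map_smul,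
      bracket_x_x, bracket_x_y, bracket_y_x, bracket_y_y, bracket_t_x, bracket_t_y,
      bracket_x_xVec, bracket_x_yVec, bracket_y_xVec, mul_zero, pow_zero, one_smul,
      mul_one, pow_one, smul_zero, neg_zero, add_zero, zero_add]
  all_goals (try split_ifs)
  all_goals first
    | omega
    | module
    | (simp only [*, yWeight_succ]; module)
    | (rw [xWeight_succ _ _ (by omega)]; simp only [*]; module)

end SolvableIndex

/-- The Lie superalgebra `SL^{n,m}`. -/
noncomputable def solvableFiliform (n m : ℕ) : LieSuperalgebra (SolvableIndex n m →₀ ℂ) :=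
  ofTable SolvableIndex.parity SolvableIndex.table SolvableIndex.table_mem
    SolvableIndex.table_skew SolvableIndex.table_jacobi

section Extension

variable {V : Type*} [AddCommGroup V] [Module ℂ V]

/-- `G` is a solvable Lie superalgebra whose square is nilpotent and whose nilradical is `N`,
isomorphic to the model filiform Lie superalgebra `L^{n,m}`. -/
structure IsSolvableWithFiliformNilradical (n m : ℕ) (G : LieSuperalgebra V)
    (N : Submodule ℂ V) : Prop where
  isSolvable : G.IsSolvable
  square_isNilpotent : G.IsNilpotent G.square
  isNilradical : G.IsNilradical N
  nilradical_iso : (G.restrict N isNilradical.isIdeal).IsIsomorphic (modelFiliform n m)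

end Extension

end LieSuperalgebra

/-!
Let `N` be the nilradical of `L`. Since `L²` is a nilpotent ideal, `L² ⊆ N`. An ideal `N + ℂ z` that
is nilpotent lies in `N`; this is how elements are shown to be in `N`. It applies to every odd `z`,
because two brackets with `z` amount to half a bracket with `[z, z] ∈ N`
(`IsNilradical.odd_le`), so `L / N` is spanned by even elements.

An even `z` acts on `N` by an even derivation, hence on `N / [N, N]`, which is spanned by the
generators `x₁, x₂, y₁` (numbered from `0` below). The latter actions commute for different `z`,
since `L² ⊆ N`. The line of `x₂` modulo `[N, N]` is automatically preserved, except for `L^{2,1}`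
and `L^{3,1}`, where `x₁` and `x₂` play symmetric roles and `x₂` can be replaced by a common
eigenvector (`IsFiliformFrame.exists_adapted`). Then every even `z` is triangular along the basis
of `N`, and its eigenvalues are determined by those on `x₁, x₂, y₁`, its weights. If the three weights vanish,
`N + ℂ z` is nilpotent, so the weights embed `L / N` into `ℂ³`
(`IsFiliformFrame.exists_weightMap`). This is the bound on the dimension.

If the dimension is `3`, there is an even `T` of weights `1, 2, 1`. It acts on the even part of `N`
with eigenvalues `1, …, n`, and on the odd part with eigenvalues `1, …, m`. Hence its eigenvectors
form a basis with the products of `L^{n,m}`. As `0` is not an eigenvalue on the even part, the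
even elements commuting with `T` form a complement of `N`; their mutual brackets lie in `N` and
commute with `T`, hence vanish, and they preserve the lines of eigenvectors of `T`. A basis of this
complement with the weights of `t₁, t₂, t₃` gives the isomorphism with `SL^{n,m}`
(`IsFiliformFrame.isIsomorphic_of_weightMap_surjective`).

In `SL^{n,m}` itself, an element of a nilpotent ideal acts nilpotently, so its weights are zero and
it lies in the span of the `xᵢ` and `yⱼ` (`isNilradical_ker_torusCoord`).
-/

/-! ### Leibniz rule, ideals and the nilradical -/

namespace LieSuperalgebra

section General

variable {V : Type*} [AddCommGroup V] [Module ℂ V] (G : LieSuperalgebra V)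

theorem exists_even_add_odd (v : V) : ∃ a ∈ G.part 0, ∃ b ∈ G.part 1, a + b = v :=
  Submodule.mem_sup.1 (G.isCompl.sup_eq_top ▸ Submodule.mem_top)

theorem eq_zero_or_eq_one_of_parity (i : ZMod 2) : i = 0 ∨ i = 1 := by
  revert i; decide

theorem bracket_swap_of_even {a : V} (ha : a ∈ G.part 0) (b : V) :
    G.bracket a b = -G.bracket b a := by
  obtain ⟨b₀, h₀, b₁, h₁, rfl⟩ := G.exists_even_add_odd b
  have e₀ := G.skew 0 0 a ha b₀ h₀
  have e₁ := G.skew 0 1 a ha b₁ h₁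
  simp only [ZMod.val_zero, zero_mul, pow_zero, one_smul] at e₀ e₁
  rw [map_add, map_add, LinearMap.add_apply, e₀, e₁, neg_add]

theorem bracket_self_of_even {a : V} (ha : a ∈ G.part 0) : G.bracket a a = 0 := by
  have h : (2 : ℂ) • G.bracket a a = 0 := by
    rw [two_smul]
    exact add_eq_zero_iff_eq_neg.2 (G.bracket_swap_of_even ha a)
  simpa using h

/-- The super Leibniz rule: `[a, ·]` is a superderivation for homogeneous `a`. -/
theorem leibniz (i j : ZMod 2) {a b : V} (ha : a ∈ G.part i) (hb : b ∈ G.part j) (c : V) :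
    G.bracket a (G.bracket b c) = G.bracket (G.bracket a b) c
      + (-1 : ℂ) ^ (i.val * j.val) • G.bracket b (G.bracket a c) := by
  have key (k : ZMod 2) (c : V) (hc : c ∈ G.part k) :
      G.bracket a (G.bracket b c) = G.bracket (G.bracket a b) c
        + (-1 : ℂ) ^ (i.val * j.val) • G.bracket b (G.bracket a c) := by
    have hJ := G.jacobi i j k a ha b hb c hc
    have h₁ := G.skew (i + j) k _ (G.bracket_mem i j a ha b hb) c hc
    have h₂ := G.skew i k a ha c hc
    rw [h₁, h₂]
    rcases eq_zero_or_eq_one_of_parity i with rfl | rfl <;>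
    rcases eq_zero_or_eq_one_of_parity j with rfl | rfl <;>
    rcases eq_zero_or_eq_one_of_parity k with rfl | rfl <;>
    · have h11 : (1 : ZMod 2) + 1 = 0 := rfl
      simp only [add_zero, zero_add, h11, ZMod.val_zero, ZMod.val_one, mul_zero,
        mul_one, pow_zero, pow_one, one_smul, neg_smul, map_neg, smul_neg, neg_neg] at hJ ⊢
      first
        | linear_combination (norm := module) (1 : ℂ) • hJ
        | linear_combination (norm := module) (-1 : ℂ) • hJ
  obtain ⟨c₀, h₀, c₁, h₁, rfl⟩ := G.exists_even_add_odd c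
  rw [map_add (G.bracket b), map_add (G.bracket a), key 0 c₀ h₀, key 1 c₁ h₁]
  simp only [map_add]
  module

theorem leibniz_of_even {a b : V} (ha : a ∈ G.part 0) (hb : b ∈ G.part 0) (c : V) :
    G.bracket a (G.bracket b c) = G.bracket (G.bracket a b) c + G.bracket b (G.bracket a c) := by
  simpa using G.leibniz 0 0 ha hb c

theorem bracket_mem_commutator {S T : Submodule ℂ V} {s t : V} (hs : s ∈ S) (ht : t ∈ T) :
    G.bracket s t ∈ G.commutator S T :=
  Submodule.apply_mem_map₂ _ hs ht

theorem commutator_le {S T U : Submodule ℂ V} :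
    G.commutator S T ≤ U ↔ ∀ s ∈ S, ∀ t ∈ T, G.bracket s t ∈ U :=
  Submodule.map₂_le

theorem commutator_mono {S S' T T' : Submodule ℂ V} (h : S ≤ S') (h' : T ≤ T') :
    G.commutator S T ≤ G.commutator S' T' :=
  Submodule.map₂_le_map₂ h h'

theorem descendingCentral_mono {S T : Submodule ℂ V} (h : S ≤ T) (k : ℕ) :
    G.descendingCentral S k ≤ G.descendingCentral T k := by
  induction k with
  | zero => exact h
  | succ k ih => exact G.commutator_mono ih h

variable {G}

theorem IsNilpotent.mono {S T : Submodule ℂ V} (hT : G.IsNilpotent T) (h : S ≤ T) :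
    G.IsNilpotent S := by
  obtain ⟨k, hk⟩ := hT
  exact ⟨k, le_bot_iff.1 (hk ▸ G.descendingCentral_mono h k)⟩

theorem isSolvable_of_isNilpotent_square (h : G.IsNilpotent G.square) : G.IsSolvable := by
  obtain ⟨k, hk⟩ := h
  have key (j : ℕ) : G.derivedSequence (j + 1) ≤ G.descendingCentral G.square j ∧
      G.derivedSequence (j + 1) ≤ G.square := by
    induction j with
    | zero => exact ⟨le_rfl, le_rfl⟩
    | succ j ih => exact ⟨G.commutator_mono ih.1 ih.2, G.commutator_mono le_top le_top⟩
  exact ⟨k + 1, le_bot_iff.1 (hk ▸ (key k).1)⟩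

namespace IsIdeal

variable {S T : Submodule ℂ V}

theorem exists_even_add_odd (hS : G.IsIdeal S) {s : V} (hs : s ∈ S) :
    ∃ a ∈ S ⊓ G.part 0, ∃ b ∈ S ⊓ G.part 1, a + b = s :=
  Submodule.mem_sup.1 (hS.graded hs)

theorem bracket_mem_right (hS : G.IsIdeal S) {s : V} (hs : s ∈ S) (a : V) :
    G.bracket s a ∈ S := by
  obtain ⟨s₀, h₀, s₁, h₁, rfl⟩ := hS.exists_even_add_odd hs
  obtain ⟨a₀, k₀, a₁, k₁, rfl⟩ := G.exists_even_add_odd a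
  have key (i j : ZMod 2) (s a : V) (hs : s ∈ S ⊓ G.part i) (ha : a ∈ G.part j) :
      G.bracket s a ∈ S := by
    rw [G.skew i j s hs.2 a ha]
    exact neg_mem (S.smul_mem _ (hS.bracket_mem a s hs.1))
  simp only [map_add, LinearMap.add_apply]
  exact add_mem (add_mem (key _ _ _ _ h₀ k₀) (key _ _ _ _ h₁ k₀))
    (add_mem (key _ _ _ _ h₀ k₁) (key _ _ _ _ h₁ k₁))

theorem top : G.IsIdeal ⊤ := ⟨by simp [G.isCompl.sup_eq_top], fun _ _ _ => Submodule.mem_top⟩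

theorem commutator (hS : G.IsIdeal S) (hT : G.IsIdeal T) : G.IsIdeal (G.commutator S T) := by
  constructor
  · rw [commutator_le]
    intro s hs t ht
    obtain ⟨s₀, h₀, s₁, h₁, rfl⟩ := hS.exists_even_add_odd hs
    obtain ⟨t₀, k₀, t₁, k₁, rfl⟩ := hT.exists_even_add_odd ht
    have key (i j : ZMod 2) (s t : V) (hs : s ∈ S ⊓ G.part i) (ht : t ∈ T ⊓ G.part j) :
        G.bracket s t ∈ G.commutator S T ⊓ G.part (i + j) :=
      ⟨G.bracket_mem_commutator hs.1 ht.1, G.bracket_mem i j s hs.2 t ht.2⟩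
    simp only [map_add, LinearMap.add_apply]
    exact add_mem
      (add_mem (Submodule.mem_sup_left (key 0 0 _ _ h₀ k₀))
        (Submodule.mem_sup_right (key 1 0 _ _ h₁ k₀)))
      (add_mem (Submodule.mem_sup_right (key 0 1 _ _ h₀ k₁))
        (Submodule.mem_sup_left (key 1 1 _ _ h₁ k₁)))
  · intro a u hu
    obtain ⟨a₀, l₀, a₁, l₁, rfl⟩ := G.exists_even_add_odd a
    have key (l : ZMod 2) (a : V) (ha : a ∈ G.part l) :
        G.commutator S T ≤ (G.commutator S T).comap (G.bracket a) := by
      rw [commutator_le]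
      intro s hs t ht
      obtain ⟨s₀, h₀, s₁, h₁, rfl⟩ := hS.exists_even_add_odd hs
      have key' (i : ZMod 2) (s : V) (hs : s ∈ S ⊓ G.part i) :
          G.bracket a (G.bracket s t) ∈ G.commutator S T := by
        rw [G.leibniz l i ha hs.2]
        exact add_mem (G.bracket_mem_commutator (hS.bracket_mem _ _ hs.1) ht)
          (Submodule.smul_mem _ _ (G.bracket_mem_commutator hs.1 (hT.bracket_mem _ _ ht)))
      rw [Submodule.mem_comap, map_add, LinearMap.add_apply, map_add]
      exact add_mem (key' 0 _ h₀) (key' 1 _ h₁)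
    rw [map_add, LinearMap.add_apply]
    exact add_mem (key 0 _ l₀ hu) (key 1 _ l₁ hu)

theorem descendingCentral (hS : G.IsIdeal S) (k : ℕ) : G.IsIdeal (G.descendingCentral S k) := by
  induction k with
  | zero => exact hS
  | succ k ih => exact ih.commutator hS

/-- If `S` contains `[G, G]`, adjoining a homogeneous element to `S` gives an ideal. -/
theorem sup_span_singleton (hS : G.IsIdeal S) (hsq : G.square ≤ S) {i : ZMod 2} {z : V}
    (hz : z ∈ G.part i) : G.IsIdeal (S ⊔ ℂ ∙ z) := by
  constructor
  · refine sup_le (hS.graded.trans (sup_le_sup (inf_le_inf_right _ le_sup_left)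
      (inf_le_inf_right _ le_sup_left))) ?_
    rw [Submodule.span_singleton_le_iff_mem]
    have hz' : z ∈ S ⊔ ℂ ∙ z := Submodule.mem_sup_right (Submodule.mem_span_singleton_self z)
    rcases eq_zero_or_eq_one_of_parity i with rfl | rfl
    · exact Submodule.mem_sup_left ⟨hz', hz⟩
    · exact Submodule.mem_sup_right ⟨hz', hz⟩
  · intro a s _
    exact Submodule.mem_sup_left
      (hsq (G.bracket_mem_commutator Submodule.mem_top Submodule.mem_top))

end IsIdeal

/-- Bracketing with an element of a nilpotent ideal is a nilpotent operator. -/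
theorem IsIdeal.exists_pow_bracket_eq_zero {I : Submodule ℂ V} (hI : G.IsIdeal I)
    (hnil : G.IsNilpotent I) {v : V} (hv : v ∈ I) :
    ∃ k : ℕ, ∀ e, ((G.bracket.flip v : Module.End ℂ V) ^ k) e = 0 := by
  obtain ⟨K, hK⟩ := hnil
  refine ⟨K + 1, fun e => ?_⟩
  have key (k : ℕ) :
      ((G.bracket.flip v : Module.End ℂ V) ^ (k + 1)) e ∈ G.descendingCentral I k := by
    induction k with
    | zero =>
      rw [zero_add, pow_one]
      exact hI.bracket_mem e v hv
    | succ k ih =>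
      rw [pow_succ', Module.End.mul_apply]
      exact G.bracket_mem_commutator ih hv
  have h := key K
  rwa [hK, Submodule.mem_bot] at h

theorem IsNilradical.square_le {N : Submodule ℂ V} (hN : G.IsNilradical N)
    (h : G.IsNilpotent G.square) : G.square ≤ N :=
  hN.le_of_isNilpotent _ (IsIdeal.top.commutator IsIdeal.top) h

/-- For odd `z` the operator `[·, z]` squares to `½ [·, [z, z]]`. -/
theorem bracket_bracket_odd {i : ZMod 2} {a z : V} (ha : a ∈ G.part i) (hz : z ∈ G.part 1) :
    G.bracket (G.bracket a z) z = (2 : ℂ)⁻¹ • G.bracket a (G.bracket z z) := by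
  have h := G.leibniz i 1 ha hz z
  have h' := G.skew (i + 1) 1 _ (G.bracket_mem i 1 a ha z hz) z hz
  rcases eq_zero_or_eq_one_of_parity i with rfl | rfl
  · simp [ZMod.val_one] at h h'
    rw [h, h']; module
  · have h11 : (1 : ZMod 2) + 1 = 0 := rfl
    simp [ZMod.val_one, h11] at h h'
    rw [h, h']; module

/-- If `[G, G]` lies in the nilradical then so does every odd element `z`: along the descending
central sequence of `N`, two brackets with `z` have the effect of one bracket with
`[z, z] ∈ N`, so that `N + ℂ z` is nilpotent. -/
theorem IsNilradical.odd_le {N : Submodule ℂ V} (hN : G.IsNilradical N) (hsq : G.square ≤ N) :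
    G.part 1 ≤ N := by
  intro z hz
  have hI := hN.isIdeal
  set S := N ⊔ ℂ ∙ z with hS
  suffices h : G.IsNilpotent S from
    hN.le_of_isNilpotent S (hI.sup_span_singleton hsq hz) h
      (Submodule.mem_sup_right (Submodule.mem_span_singleton_self z))
  obtain ⟨k, hk⟩ := hN.isNilpotent
  -- Two steps of the sequence of `S` make one of that of `N`, after a first step from `S` into `N`.
  refine ⟨2 * k + 1, le_bot_iff.1 (hk ▸ ?_)⟩
  clear hk
  induction k with
  | zero => exact (G.commutator_mono le_top le_top).trans hsq
  | succ k ih =>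
    have hk := hI.descendingCentral k
    have hk' := hI.descendingCentral (k + 1)
    have hzz : G.bracket z z ∈ N := hsq (G.bracket_mem_commutator trivial trivial)
    have hodd {a : V} (ha : a ∈ G.descendingCentral N k) :
        G.bracket (G.bracket a z) z ∈ G.descendingCentral N (k + 1) := by
      obtain ⟨a₀, h₀, a₁, h₁, rfl⟩ := hk.exists_even_add_odd ha
      simp only [map_add, LinearMap.add_apply]
      rw [bracket_bracket_odd h₀.2 hz, bracket_bracket_odd h₁.2 hz]
      exact add_mem (Submodule.smul_mem _ _ (G.bracket_mem_commutator h₀.1 hzz))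
        (Submodule.smul_mem _ _ (G.bracket_mem_commutator h₁.1 hzz))
    have hstep : G.commutator (G.commutator (G.descendingCentral N k) S) S
        ≤ G.descendingCentral N (k + 1) := by
      rw [commutator_le]
      intro b hb s hs
      have : G.commutator (G.descendingCentral N k) S
          ≤ (G.descendingCentral N (k + 1)).comap (G.bracket.flip s) := by
        rw [commutator_le]
        intro a ha r hr
        obtain ⟨p, hp, _, hz₁, rfl⟩ := Submodule.mem_sup.1 hr
        obtain ⟨c, rfl⟩ := Submodule.mem_span_singleton.1 hz₁
        obtain ⟨q, hq, _, hz₂, rfl⟩ := Submodule.mem_sup.1 hs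
        obtain ⟨d, rfl⟩ := Submodule.mem_span_singleton.1 hz₂
        rw [Submodule.mem_comap, LinearMap.flip_apply, map_add (G.bracket a),
          map_add G.bracket, LinearMap.add_apply]
        refine add_mem (hk'.bracket_mem_right (G.bracket_mem_commutator ha hp) _) ?_
        rw [map_add]
        refine add_mem (G.bracket_mem_commutator (hk.bracket_mem_right ha _) hq) ?_
        simp only [map_smul, LinearMap.smul_apply]
        exact Submodule.smul_mem _ _ (Submodule.smul_mem _ _ (hodd ha))
      exact this hb
    exact (G.commutator_mono (G.commutator_mono ih le_rfl) le_rfl).trans hstep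

end General

end LieSuperalgebra

/-! ### Triangular operators and linear algebra -/

section Triangular

variable {V : Type*} [AddCommGroup V] [Module ℂ V]

/-- The span of the vectors `e i` with `i ≥ k`. For a sequence `e` that is eventually zero these
subspaces form a finite descending flag. -/
def tailSpan (e : ℕ → V) (k : ℕ) : Submodule ℂ V := Submodule.span ℂ (e '' Set.Ici k)

variable {e : ℕ → V} {k : ℕ}

theorem mem_tailSpan {i : ℕ} (h : k ≤ i) : e i ∈ tailSpan e k :=
  Submodule.subset_span ⟨i, h, rfl⟩

theorem tailSpan_le {S : Submodule ℂ V} : tailSpan e k ≤ S ↔ ∀ i, k ≤ i → e i ∈ S := by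
  rw [tailSpan, Submodule.span_le, Set.image_subset_iff]
  rfl

theorem tailSpan_anti {l : ℕ} (h : k ≤ l) : tailSpan e l ≤ tailSpan e k :=
  tailSpan_le.2 fun _ hi => mem_tailSpan (h.trans hi)

theorem tailSpan_eq_bot {n : ℕ} (he : ∀ i, n ≤ i → e i = 0) (h : n ≤ k) : tailSpan e k = ⊥ :=
  le_bot_iff.1 (tailSpan_le.2 fun i hi => by simp [he i (h.trans hi)])

theorem exists_sub_smul_mem_tailSpan {u : V} (hu : u ∈ tailSpan e k) :
    ∃ c : ℂ, u - c • e k ∈ tailSpan e (k + 1) := by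
  have : tailSpan e k ≤ (ℂ ∙ e k) ⊔ tailSpan e (k + 1) := by
    refine tailSpan_le.2 fun i hi => ?_
    rcases hi.eq_or_lt with rfl | hi
    · exact Submodule.mem_sup_left (Submodule.mem_span_singleton_self _)
    · exact Submodule.mem_sup_right (mem_tailSpan hi)
  obtain ⟨a, ha, b, hb, rfl⟩ := Submodule.mem_sup.1 (this hu)
  obtain ⟨c, rfl⟩ := Submodule.mem_span_singleton.1 ha
  exact ⟨c, by simpa using hb⟩

theorem mem_tailSpan_of_sub {c : ℂ} {u : V} (h : u - c • e k ∈ tailSpan e (k + 1)) :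
    u ∈ tailSpan e k := by
  rw [← sub_add_cancel u (c • e k)]
  exact add_mem (tailSpan_anti k.le_succ h) (Submodule.smul_mem _ _ (mem_tailSpan le_rfl))

theorem map_mem_tailSpan {D : V →ₗ[ℂ] V} {l : ℕ} {f : ℕ → V}
    (h : ∀ i, k ≤ i → D (e i) ∈ tailSpan f l) {u : V} (hu : u ∈ tailSpan e k) :
    D u ∈ tailSpan f l :=
  (tailSpan_le (S := (tailSpan f l).comap D)).2 h hu

variable {D : V →ₗ[ℂ] V} {n : ℕ}

/-- If `D` is triangular along `e` with eigenvalues `1, 2, …`, then `D - k` is surjective on the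
`k`-th tail. -/
theorem exists_map_sub_smul_eq (he : ∀ i, n ≤ i → e i = 0)
    (hD : ∀ i : ℕ, D (e i) - ((i : ℂ) + 1) • e i ∈ tailSpan e (i + 1)) {r : V}
    (hr : r ∈ tailSpan e k) : ∃ u ∈ tailSpan e k, D u - (k : ℂ) • u = r := by
  suffices H : ∀ d j, k ≤ j → n ≤ j + d → ∀ r ∈ tailSpan e j,
      ∃ u ∈ tailSpan e j, D u - (k : ℂ) • u = r from H n k le_rfl (by omega) r hr
  intro d
  induction d with
  | zero =>
    intro j _ hn r hr
    rw [tailSpan_eq_bot he (by omega), Submodule.mem_bot] at hr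
    exact ⟨0, zero_mem _, by simp [hr]⟩
  | succ d ih =>
    intro j hj hn r hr
    obtain ⟨c, hc⟩ := exists_sub_smul_mem_tailSpan hr
    have hne : (j : ℂ) + 1 - k ≠ 0 := by
      have : (j : ℂ) + 1 - k = ((j + 1 - k : ℕ) : ℂ) := by
        rw [Nat.cast_sub (by omega)]; push_cast; ring
      rw [this, Nat.cast_ne_zero]
      omega
    set a : ℂ := c / ((j : ℂ) + 1 - k) with ha
    obtain ⟨u, hu, hur⟩ := ih (j + 1) (by omega) (by omega)
      (r - c • e j - a • (D (e j) - ((j : ℂ) + 1) • e j))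
      (sub_mem hc (Submodule.smul_mem _ _ (hD j)))
    refine ⟨a • e j + u, add_mem (Submodule.smul_mem _ _ (mem_tailSpan le_rfl))
      (tailSpan_anti j.le_succ hu), ?_⟩
    have hac : c = a * ((j : ℂ) + 1 - k) := by rw [ha]; field_simp
    rw [map_add, map_smul, ← sub_eq_zero]
    rw [← sub_eq_zero] at hur
    rw [← hur, hac]
    module

/-- If `D` is triangular along `e` with eigenvalues `1, 2, …`, then `D - k` is injective on the
`k`-th tail. -/
theorem eq_zero_of_map_eq_smul (he : ∀ i, n ≤ i → e i = 0)
    (hD : ∀ i : ℕ, D (e i) - ((i : ℂ) + 1) • e i ∈ tailSpan e (i + 1)) {u : V}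
    (hu : u ∈ tailSpan e k) (h : D u = (k : ℂ) • u) : u = 0 := by
  have key (d : ℕ) : u ∈ tailSpan e (k + d) := by
    induction d with
    | zero => exact hu
    | succ d ih =>
      obtain ⟨c, hc⟩ := exists_sub_smul_mem_tailSpan ih
      have hDt : D (u - c • e (k + d)) ∈ tailSpan e (k + d + 1) :=
        map_mem_tailSpan (fun i hi => tailSpan_anti hi (mem_tailSpan_of_sub (hD i))) hc
      have h₁ : ((d : ℂ) + 1) • c • e (k + d) ∈ tailSpan e (k + d + 1) := by
        have h₂ := sub_mem (sub_mem (Submodule.smul_mem _ (k : ℂ) hc) hDt)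
          (Submodule.smul_mem _ c (hD (k + d)))
        convert h₂ using 1
        rw [map_sub, map_smul, h]
        push_cast
        module
      have h₃ : c • e (k + d) ∈ tailSpan e (k + d + 1) :=
        (Submodule.smul_mem_iff _ (by exact_mod_cast d.succ_ne_zero)).1 h₁
      rw [← sub_add_cancel u (c • e (k + d))]
      exact add_mem hc h₃
  have := key n
  rwa [tailSpan_eq_bot he (by omega), Submodule.mem_bot] at this

/-- If `D` is triangular along `e` with eigenvalues `1, 2, …`, then it has an eigenvector with
leading term `e k` for each `k`. -/
theorem exists_eigenvector_sub_mem_tailSpan (he : ∀ i, n ≤ i → e i = 0)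
    (hD : ∀ i : ℕ, D (e i) - ((i : ℂ) + 1) • e i ∈ tailSpan e (i + 1)) (k : ℕ) :
    ∃ v, v - e k ∈ tailSpan e (k + 1) ∧ D v = ((k : ℂ) + 1) • v := by
  obtain ⟨u, hu, h⟩ := exists_map_sub_smul_eq he hD (neg_mem (hD k))
  refine ⟨e k + u, by simpa using hu, ?_⟩
  rw [map_add, ← sub_eq_zero]
  rw [← sub_eq_zero] at h
  rw [← h]
  push_cast
  module

/-- Sequences with the same leading terms have the same tails. -/
theorem tailSpan_eq_of_sub_mem {f : ℕ → V} (he : ∀ i, n ≤ i → e i = 0)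
    (hf : ∀ i, f i - e i ∈ tailSpan e (i + 1)) (k : ℕ) : tailSpan f k = tailSpan e k := by
  refine le_antisymm (tailSpan_le.2 fun i hi => ?_) ?_
  · exact tailSpan_anti hi (mem_tailSpan_of_sub (c := 1) (by simpa using hf i))
  · suffices H : ∀ d j, k ≤ j → n ≤ j + d → tailSpan e j ≤ tailSpan f k from
      H n k le_rfl (by omega)
    intro d
    induction d with
    | zero =>
      intro j _ hn
      rw [tailSpan_eq_bot he (by omega)]
      exact bot_le
    | succ d ih =>
      intro j hj hn u hu
      obtain ⟨c, hc⟩ := exists_sub_smul_mem_tailSpan hu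
      have h₁ := ih (j + 1) (by omega) (by omega)
      have h₂ : e j ∈ tailSpan f k := by
        rw [← sub_sub_cancel (f j) (e j)]
        exact sub_mem (mem_tailSpan hj) (h₁ (hf j))
      rw [← sub_add_cancel u (c • e j)]
      exact add_mem (h₁ hc) (Submodule.smul_mem _ _ h₂)

/-- If `e` is an eigenvector of `D` with eigenvalue `μ` modulo an invariant subspace that does not
contain it, and a power of `D` kills `e`, then `μ = 0`. -/
theorem eigenvalue_eq_zero_of_pow_apply_eq_zero {S : Submodule ℂ V} {e : V} {μ : ℂ} (he : e ∉ S)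
    (hS : ∀ s ∈ S, D s ∈ S) (h : D e - μ • e ∈ S) {k : ℕ} (hk : (D ^ k) e = 0) : μ = 0 := by
  have key (j : ℕ) : (D ^ j) e - μ ^ j • e ∈ S := by
    induction j with
    | zero => simp
    | succ j ih =>
      have := add_mem (hS _ ih) (S.smul_mem (μ ^ j) h)
      rw [pow_succ', Module.End.mul_apply]
      convert this using 1
      rw [map_sub, map_smul]
      module
  by_contra hμ
  have := key k
  rw [hk, zero_sub, neg_mem_iff, Submodule.smul_mem_iff _ (pow_ne_zero _ hμ)] at this
  exact he this

end Triangular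

theorem LinearIndependent.exists_dual {ι V : Type*} [AddCommGroup V] [Module ℂ V] {v : ι → V}
    (hv : LinearIndependent ℂ v) (i : ι) :
    ∃ f : V →ₗ[ℂ] ℂ, f (v i) = 1 ∧ ∀ j, j ≠ i → f (v j) = 0 := by
  obtain ⟨f, hf⟩ := LinearMap.exists_extend (Finsupp.lapply i ∘ₗ hv.repr)
  have key (j : ι) : f (v j) = (Finsupp.single j 1 : ι →₀ ℂ) i := by
    have := LinearMap.congr_fun hf ⟨v j, Submodule.subset_span ⟨j, rfl⟩⟩
    rw [LinearMap.comp_apply, LinearMap.comp_apply] at this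
    refine this.trans ?_
    rw [LinearIndependent.repr_eq_single hv j ⟨v j, _⟩ rfl]
    rfl
  exact ⟨f, by simp [key], fun j hj => by simp [key, hj]⟩

/-- Commuting complex `2 × 2` matrices have a common eigenvector: an eigenvector of a non-scalar
one spans its eigenspace, which the others preserve. -/
theorem exists_common_eigenvector (S : Set (Matrix (Fin 2) (Fin 2) ℂ))
    (hS : ∀ A ∈ S, ∀ B ∈ S, A * B = B * A) :
    ∃ v : Fin 2 → ℂ, v ≠ 0 ∧ ∀ A ∈ S, ∃ μ : ℂ, A.mulVec v = μ • v := by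
  by_cases hsc : ∀ A ∈ S, ∃ μ : ℂ, A = Matrix.scalar (Fin 2) μ
  · refine ⟨1, one_ne_zero, fun A hA => ?_⟩
    obtain ⟨μ, rfl⟩ := hsc A hA
    exact ⟨μ, by simp [← Matrix.smul_one_eq_diagonal, Matrix.smul_mulVec]⟩
  push Not at hsc
  obtain ⟨A, hA, hAs⟩ := hsc
  obtain ⟨μ, hμ⟩ := Module.End.exists_eigenvalue (Matrix.toLin' A)
  obtain ⟨v, hv⟩ := hμ.exists_hasEigenvector
  have hAv : A.mulVec v = μ • v := by simpa using hv.apply_eq_smul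
  refine ⟨v, hv.2, fun B hB => ?_⟩
  have hABv : A.mulVec (B.mulVec v) = μ • B.mulVec v := by
    rw [Matrix.mulVec_mulVec, hS A hA B hB, ← Matrix.mulVec_mulVec, hAv, Matrix.mulVec_smul]
  by_contra! hne
  obtain ⟨w, hw⟩ : ∃ w, w = B.mulVec v := ⟨_, rfl⟩
  rw [← hw] at hABv hne
  have hli : LinearIndependent ℂ ![v, w] :=
    (LinearIndependent.pair_iff' hv.2).2 fun a h => hne a h.symm
  refine hAs μ (Matrix.toLin'.injective
    ((basisOfLinearIndependentOfCardEqFinrank hli (by simp)).ext fun i => ?_))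
  rw [coe_basisOfLinearIndependentOfCardEqFinrank]
  fin_cases i
  · simp [hAv, ← Matrix.smul_one_eq_diagonal]
  · simp [hABv, ← Matrix.smul_one_eq_diagonal]

/-! ### Filiform frames and weights -/

namespace LieSuperalgebra

section Frame

variable {V : Type*} [AddCommGroup V] [Module ℂ V]

/-- `x`, `y` are sequences of even and odd vectors that satisfy the multiplication table of
`L^{n,m}` and whose non-zero terms form a basis of `N`. As in the table of `L^{n,m}`, the
numbering starts at `0`, and terms out of range are `0`. That the terms in range are linearly
independent is encoded in the dimension of `N`. -/
structure IsFiliformFrame (G : LieSuperalgebra V) (N : Submodule ℂ V) (n m : ℕ)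
    (x y : ℕ → V) : Prop where
  x_mem : ∀ k, x k ∈ G.part 0
  y_mem : ∀ k, y k ∈ G.part 1
  x_eq_zero : ∀ k, n ≤ k → x k = 0
  y_eq_zero : ∀ k, m ≤ k → y k = 0
  bracket_zero_x : ∀ k, G.bracket (x 0) (x (k + 1)) = x (k + 2)
  bracket_zero_y : ∀ k, G.bracket (x 0) (y k) = y (k + 1)
  bracket_succ_x : ∀ i j, G.bracket (x (i + 1)) (x (j + 1)) = 0
  bracket_succ_y : ∀ i j, G.bracket (x (i + 1)) (y j) = 0
  bracket_y_y : ∀ i j, G.bracket (y i) (y j) = 0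
  sup_eq : tailSpan x 0 ⊔ tailSpan y 0 = N
  finrank_eq : Module.finrank ℂ N = n + m

/-- The even element `z` acts on the generators `x 0`, `x 1`, `y 0` of a filiform frame with
eigenvalues `α`, `β`, `γ`, up to later vectors of the frame. -/
structure HasWeights (G : LieSuperalgebra V) (x y : ℕ → V) (z : V) (α β γ : ℂ) : Prop where
  even : z ∈ G.part 0
  x_zero : G.bracket z (x 0) - α • x 0 ∈ tailSpan x 1
  x_one : G.bracket z (x 1) - β • x 1 ∈ tailSpan x 2
  y_zero : G.bracket z (y 0) - γ • y 0 ∈ tailSpan y 1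

/-- The weight of `x k`, when `x 0` has weight `α` and `x 1` has weight `β`. -/
def evenWeight (α β : ℂ) : ℕ → ℂ
  | 0 => α
  | k + 1 => β + k * α

/-- The flag spanned by the tails of both sequences. -/
def flag (x y : ℕ → V) (k : ℕ) : Submodule ℂ V := tailSpan x k ⊔ tailSpan y k

theorem flag_anti {x y : ℕ → V} {k l : ℕ} (h : k ≤ l) : flag x y l ≤ flag x y k :=
  sup_le_sup (tailSpan_anti h) (tailSpan_anti h)

theorem flag_le {x y : ℕ → V} {k : ℕ} {S : Submodule ℂ V} :
    flag x y k ≤ S ↔ (∀ i, k ≤ i → x i ∈ S) ∧ ∀ i, k ≤ i → y i ∈ S := by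
  rw [flag, sup_le_iff, tailSpan_le, tailSpan_le]

theorem tailSpan_le_flag_left (x y : ℕ → V) (k : ℕ) : tailSpan x k ≤ flag x y k := le_sup_left

theorem tailSpan_le_flag_right (x y : ℕ → V) (k : ℕ) : tailSpan y k ≤ flag x y k := le_sup_right

theorem span_range_sumElim_eq_flag {n m : ℕ} {x y : ℕ → V} (hx : ∀ k, n ≤ k → x k = 0)
    (hy : ∀ k, m ≤ k → y k = 0) :
    Submodule.span ℂ (Set.range (Sum.elim (fun i : Fin n => x i) fun j : Fin m => y j))
      = flag x y 0 := by
  rw [Set.Sum.elim_range]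
  apply le_antisymm
  · rw [Submodule.span_le]
    rintro _ (⟨i, rfl⟩ | ⟨j, rfl⟩)
    · exact Submodule.mem_sup_left (mem_tailSpan (Nat.zero_le _))
    · exact Submodule.mem_sup_right (mem_tailSpan (Nat.zero_le _))
  · refine sup_le (tailSpan_le.2 fun i _ => ?_) (tailSpan_le.2 fun j _ => ?_)
    · by_cases hi : i < n
      · exact Submodule.subset_span (Or.inl ⟨⟨i, hi⟩, rfl⟩)
      · simp [hx i (not_lt.1 hi)]
    · by_cases hj : j < m
      · exact Submodule.subset_span (Or.inr ⟨⟨j, hj⟩, rfl⟩)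
      · simp [hy j (not_lt.1 hj)]

namespace IsFiliformFrame

variable {G : LieSuperalgebra V} {N : Submodule ℂ V} {n m : ℕ} {x y : ℕ → V}

theorem span_eq (h : IsFiliformFrame G N n m x y) :
    Submodule.span ℂ (Set.range (Sum.elim (fun i : Fin n => x i) fun j : Fin m => y j)) = N :=
  (span_range_sumElim_eq_flag h.x_eq_zero h.y_eq_zero).trans h.sup_eq

theorem linearIndependent (h : IsFiliformFrame G N n m x y) :
    LinearIndependent ℂ (Sum.elim (fun i : Fin n => x i) fun j : Fin m => y j) := by
  rw [linearIndependent_iff_card_eq_finrank_span, Set.finrank, h.span_eq, h.finrank_eq]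
  simp

theorem exists_dual_x (h : IsFiliformFrame G N n m x y) {k : ℕ} (hk : k < n) :
    ∃ f : V →ₗ[ℂ] ℂ, f (x k) = 1 ∧ (∀ i, i ≠ k → f (x i) = 0) ∧ ∀ j, f (y j) = 0 := by
  obtain ⟨f, hf, hf'⟩ := h.linearIndependent.exists_dual (Sum.inl ⟨k, hk⟩)
  refine ⟨f, hf, fun i hi => ?_, fun j => ?_⟩
  · by_cases hin : i < n
    · exact hf' (Sum.inl ⟨i, hin⟩) (by simpa using hi)
    · rw [h.x_eq_zero i (not_lt.1 hin), map_zero]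
  · by_cases hjm : j < m
    · exact hf' (Sum.inr ⟨j, hjm⟩) (by simp)
    · rw [h.y_eq_zero j (not_lt.1 hjm), map_zero]

theorem exists_dual_y (h : IsFiliformFrame G N n m x y) {k : ℕ} (hk : k < m) :
    ∃ f : V →ₗ[ℂ] ℂ, f (y k) = 1 ∧ (∀ i, f (x i) = 0) ∧ ∀ j, j ≠ k → f (y j) = 0 := by
  obtain ⟨f, hf, hf'⟩ := h.linearIndependent.exists_dual (Sum.inr ⟨k, hk⟩)
  refine ⟨f, hf, fun i => ?_, fun j hj => ?_⟩
  · by_cases hin : i < n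
    · exact hf' (Sum.inl ⟨i, hin⟩) (by simp)
    · rw [h.x_eq_zero i (not_lt.1 hin), map_zero]
  · by_cases hjm : j < m
    · exact hf' (Sum.inr ⟨j, hjm⟩) (by simpa using hj)
    · rw [h.y_eq_zero j (not_lt.1 hjm), map_zero]

theorem tailSpan_x_le (h : IsFiliformFrame G N n m x y) (k : ℕ) :
    tailSpan x k ≤ N ⊓ G.part 0 :=
  le_inf ((tailSpan_anti (Nat.zero_le k)).trans (h.sup_eq ▸ le_sup_left))
    (tailSpan_le.2 fun i _ => h.x_mem i)

theorem tailSpan_y_le (h : IsFiliformFrame G N n m x y) (k : ℕ) :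
    tailSpan y k ≤ N ⊓ G.part 1 :=
  le_inf ((tailSpan_anti (Nat.zero_le k)).trans (h.sup_eq ▸ le_sup_right))
    (tailSpan_le.2 fun i _ => h.y_mem i)

theorem exists_add_of_mem (h : IsFiliformFrame G N n m x y) {u : V} (hu : u ∈ N) :
    ∃ a ∈ tailSpan x 0, ∃ b ∈ tailSpan y 0, a + b = u :=
  Submodule.mem_sup.1 (h.sup_eq.symm ▸ hu)

theorem mem_tailSpan_x (h : IsFiliformFrame G N n m x y) {u : V} (hu : u ∈ N)
    (hu₀ : u ∈ G.part 0) : u ∈ tailSpan x 0 := by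
  obtain ⟨a, ha, b, hb, rfl⟩ := h.exists_add_of_mem hu
  have hb' : b ∈ G.part 0 := by
    simpa using sub_mem hu₀ (h.tailSpan_x_le 0 ha).2
  rwa [Submodule.disjoint_def.1 G.isCompl.disjoint b hb' (h.tailSpan_y_le 0 hb).2, add_zero]

theorem mem_tailSpan_y (h : IsFiliformFrame G N n m x y) {u : V} (hu : u ∈ N)
    (hu₁ : u ∈ G.part 1) : u ∈ tailSpan y 0 := by
  obtain ⟨a, ha, b, hb, rfl⟩ := h.exists_add_of_mem hu
  have ha' : a ∈ G.part 1 := by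
    simpa using sub_mem hu₁ (h.tailSpan_y_le 0 hb).2
  rwa [Submodule.disjoint_def.1 G.isCompl.disjoint a (h.tailSpan_x_le 0 ha).2 ha', zero_add]

theorem bracket_x_x_eq_zero (h : IsFiliformFrame G N n m x y) {u v : V}
    (hu : u ∈ tailSpan x 1) (hv : v ∈ tailSpan x 1) : G.bracket u v = 0 := by
  have h₁ : tailSpan x 1 ≤ LinearMap.ker (G.bracket.flip v) := by
    refine tailSpan_le.2 fun i hi => ?_
    obtain ⟨i, rfl⟩ := Nat.exists_eq_add_of_le' hi
    have h₂ : tailSpan x 1 ≤ LinearMap.ker (G.bracket (x (i + 1))) := by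
      refine tailSpan_le.2 fun j hj => ?_
      obtain ⟨j, rfl⟩ := Nat.exists_eq_add_of_le' hj
      exact h.bracket_succ_x i j
    exact h₂ hv
  exact h₁ hu

theorem bracket_x_y_eq_zero (h : IsFiliformFrame G N n m x y) {u v : V}
    (hu : u ∈ tailSpan x 1) (hv : v ∈ tailSpan y 0) : G.bracket u v = 0 := by
  have h₁ : tailSpan x 1 ≤ LinearMap.ker (G.bracket.flip v) := by
    refine tailSpan_le.2 fun i hi => ?_
    obtain ⟨i, rfl⟩ := Nat.exists_eq_add_of_le' hi
    have h₂ : tailSpan y 0 ≤ LinearMap.ker (G.bracket (x (i + 1))) :=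
      tailSpan_le.2 fun j _ => h.bracket_succ_y i j
    exact h₂ hv
  exact h₁ hu

theorem bracket_y_y_eq_zero (h : IsFiliformFrame G N n m x y) {u v : V}
    (hu : u ∈ tailSpan y 0) (hv : v ∈ tailSpan y 0) : G.bracket u v = 0 := by
  have h₁ : tailSpan y 0 ≤ LinearMap.ker (G.bracket.flip v) := by
    refine tailSpan_le.2 fun i _ => ?_
    have h₂ : tailSpan y 0 ≤ LinearMap.ker (G.bracket (y i)) :=
      tailSpan_le.2 fun j _ => h.bracket_y_y i j
    exact h₂ hv
  exact h₁ hu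

theorem bracket_zero_mem_x (h : IsFiliformFrame G N n m x y) {v : V} {k : ℕ}
    (hv : v ∈ tailSpan x (k + 1)) : G.bracket (x 0) v ∈ tailSpan x (k + 2) := by
  refine map_mem_tailSpan (fun i hi => ?_) hv
  obtain ⟨i, rfl⟩ := Nat.exists_eq_add_of_le' ((Nat.le_add_left 1 k).trans hi)
  rw [h.bracket_zero_x]
  exact mem_tailSpan (by omega)

theorem bracket_zero_mem_y (h : IsFiliformFrame G N n m x y) {v : V} {k : ℕ}
    (hv : v ∈ tailSpan y k) : G.bracket (x 0) v ∈ tailSpan y (k + 1) := by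
  refine map_mem_tailSpan (fun i hi => ?_) hv
  rw [h.bracket_zero_y]
  exact mem_tailSpan (by omega)

theorem bracket_mem_x (h : IsFiliformFrame G N n m x y) {u v : V} {k : ℕ}
    (hu : u ∈ tailSpan x 0) (hv : v ∈ tailSpan x (k + 1)) :
    G.bracket u v ∈ tailSpan x (k + 2) := by
  obtain ⟨c, hc⟩ := exists_sub_smul_mem_tailSpan hu
  rw [← sub_add_cancel u (c • x 0), map_add, LinearMap.add_apply, map_smul, LinearMap.smul_apply,
    h.bracket_x_x_eq_zero hc (tailSpan_anti (by omega) hv), zero_add]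
  exact Submodule.smul_mem _ _ (h.bracket_zero_mem_x hv)

theorem bracket_mem_y (h : IsFiliformFrame G N n m x y) {u v : V} {k : ℕ}
    (hu : u ∈ tailSpan x 0) (hv : v ∈ tailSpan y k) :
    G.bracket u v ∈ tailSpan y (k + 1) := by
  obtain ⟨c, hc⟩ := exists_sub_smul_mem_tailSpan hu
  rw [← sub_add_cancel u (c • x 0), map_add, LinearMap.add_apply, map_smul, LinearMap.smul_apply,
    h.bracket_x_y_eq_zero hc (tailSpan_anti (Nat.zero_le k) hv), zero_add]
  exact Submodule.smul_mem _ _ (h.bracket_zero_mem_y hv)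

theorem bracket_x_zero_mem (h : IsFiliformFrame G N n m x y) {u : V}
    (hu : u ∈ tailSpan x 0) : G.bracket u (x 0) ∈ tailSpan x 2 := by
  have h₀ : G.bracket (x 0) (x 0) = 0 := G.bracket_self_of_even (h.x_mem 0)
  obtain ⟨c, hc⟩ := exists_sub_smul_mem_tailSpan hu
  rw [← sub_add_cancel u (c • x 0), map_add, LinearMap.add_apply, map_smul, LinearMap.smul_apply,
    h₀, smul_zero, add_zero, G.bracket_swap_of_even (h.tailSpan_x_le _ hc).2]
  exact neg_mem (h.bracket_zero_mem_x hc)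

theorem bracket_x_mem (h : IsFiliformFrame G N n m x y) {u : V}
    (hu : u ∈ tailSpan x 0) (k : ℕ) : G.bracket u (x k) ∈ tailSpan x (k + 1) := by
  rcases k with _ | k
  · exact tailSpan_anti one_le_two (h.bracket_x_zero_mem hu)
  · exact h.bracket_mem_x hu (mem_tailSpan le_rfl)

theorem bracket_x_x_mem (h : IsFiliformFrame G N n m x y) {u v : V}
    (hu : u ∈ tailSpan x 0) (hv : v ∈ tailSpan x 0) : G.bracket u v ∈ tailSpan x 2 := by
  obtain ⟨c, hc⟩ := exists_sub_smul_mem_tailSpan hv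
  rw [← sub_add_cancel v (c • x 0), map_add, map_smul]
  exact add_mem (h.bracket_mem_x hu hc) (Submodule.smul_mem _ _ (h.bracket_x_zero_mem hu))

theorem flag_zero (h : IsFiliformFrame G N n m x y) : flag x y 0 = N := h.sup_eq

theorem bracket_flag_mem (h : IsFiliformFrame G N n m x y) {a u : V} {k : ℕ}
    (ha : a ∈ flag x y k) (hu : u ∈ N) : G.bracket a u ∈ flag x y (k + 1) := by
  obtain ⟨p, hp, q, hq, rfl⟩ := h.exists_add_of_mem hu
  refine (flag_le (S := (flag x y (k + 1)).comap (G.bracket.flip (p + q)))).2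
    ⟨fun i hi => ?_, fun i hi => ?_⟩ ha
  · rw [Submodule.mem_comap, LinearMap.flip_apply, map_add]
    refine add_mem ?_ ?_
    · rw [G.bracket_swap_of_even (h.x_mem i)]
      exact neg_mem (flag_anti (by omega : k + 1 ≤ i + 1)
        (tailSpan_le_flag_left x y _ (h.bracket_x_mem hp i)))
    · rcases i with _ | i
      · exact flag_anti (by omega : k + 1 ≤ 1)
          (tailSpan_le_flag_right x y _ (h.bracket_zero_mem_y hq))
      · rw [h.bracket_x_y_eq_zero (mem_tailSpan (by omega)) hq]
        exact zero_mem _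
  · rw [Submodule.mem_comap, LinearMap.flip_apply, map_add,
      h.bracket_y_y_eq_zero (mem_tailSpan (Nat.zero_le i)) hq, add_zero,
      ← neg_neg (G.bracket (y i) p), ← G.bracket_swap_of_even (h.tailSpan_x_le 0 hp).2]
    exact neg_mem (flag_anti (by omega : k + 1 ≤ i + 1)
        (tailSpan_le_flag_right x y _ (h.bracket_mem_y hp (mem_tailSpan le_rfl))))

section HasWeights

variable {z : V} {α β γ : ℂ}

theorem bracket_even_x (h : IsFiliformFrame G N n m x y) (hz : HasWeights G x y z α β γ) (k : ℕ) :
    G.bracket z (x k) - evenWeight α β k • x k ∈ tailSpan x (k + 1) := by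
  rcases k with _ | k
  · exact hz.x_zero
  induction k with
  | zero => simpa [evenWeight] using hz.x_one
  | succ k ih =>
    have hx := h.bracket_x_x_eq_zero hz.x_zero (mem_tailSpan (Nat.le_add_left 1 k))
    have hs := h.bracket_zero_mem_x ih
    rw [map_sub, LinearMap.sub_apply, map_smul, LinearMap.smul_apply, h.bracket_zero_x,
      sub_eq_zero] at hx
    rw [map_sub, map_smul, h.bracket_zero_x] at hs
    convert hs using 1
    rw [← h.bracket_zero_x k, G.leibniz_of_even hz.even (h.x_mem 0), h.bracket_zero_x, hx]
    simp only [evenWeight]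
    push_cast
    module

theorem bracket_even_y (h : IsFiliformFrame G N n m x y) (hz : HasWeights G x y z α β γ) (k : ℕ) :
    G.bracket z (y k) - (γ + k * α) • y k ∈ tailSpan y (k + 1) := by
  induction k with
  | zero => simpa using hz.y_zero
  | succ k ih =>
    have hx := h.bracket_x_y_eq_zero hz.x_zero (mem_tailSpan k.zero_le)
    have hs := h.bracket_zero_mem_y ih
    rw [map_sub, LinearMap.sub_apply, map_smul, LinearMap.smul_apply, h.bracket_zero_y,
      sub_eq_zero] at hx
    rw [map_sub, map_smul, h.bracket_zero_y] at hs
    convert hs using 1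
    rw [← h.bracket_zero_y k, G.leibniz_of_even hz.even (h.x_mem 0), h.bracket_zero_y, hx]
    push_cast
    module

theorem bracket_flag_even_mem (h : IsFiliformFrame G N n m x y)
    (hz : HasWeights G x y z α β γ) {a : V} {k : ℕ} (ha : a ∈ flag x y k) :
    G.bracket a z ∈ flag x y k := by
  rw [← neg_neg (G.bracket a z), ← G.bracket_swap_of_even hz.even]
  refine neg_mem ((flag_le (S := (flag x y k).comap (G.bracket z))).2
    ⟨fun i hi => ?_, fun i hi => ?_⟩ ha)
  · exact flag_anti hi (tailSpan_le_flag_left x y _ (mem_tailSpan_of_sub (h.bracket_even_x hz i)))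
  · exact flag_anti hi (tailSpan_le_flag_right x y _ (mem_tailSpan_of_sub (h.bracket_even_y hz i)))

theorem bracket_flag_mem_of_weights_zero (h : IsFiliformFrame G N n m x y)
    (hz : HasWeights G x y z 0 0 0) {a : V} {k : ℕ} (ha : a ∈ flag x y k) :
    G.bracket a z ∈ flag x y (k + 1) := by
  rw [← neg_neg (G.bracket a z), ← G.bracket_swap_of_even hz.even]
  refine neg_mem ((flag_le (S := (flag x y (k + 1)).comap (G.bracket z))).2
    ⟨fun i hi => ?_, fun i hi => ?_⟩ ha)
  · have h₀ : evenWeight 0 0 i = 0 := by cases i <;> simp [evenWeight]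
    have := h.bracket_even_x hz i
    rw [h₀, zero_smul, sub_zero] at this
    exact flag_anti (Nat.succ_le_succ hi) (tailSpan_le_flag_left x y _ this)
  · have := h.bracket_even_y hz i
    rw [mul_zero, add_zero, zero_smul, sub_zero] at this
    exact flag_anti (Nat.succ_le_succ hi) (tailSpan_le_flag_right x y _ this)

end HasWeights

theorem flag_eq_bot (h : IsFiliformFrame G N n m x y) : flag x y (n + m) = ⊥ := by
  rw [flag, tailSpan_eq_bot h.x_eq_zero (by omega), tailSpan_eq_bot h.y_eq_zero (by omega),
    bot_sup_eq]

theorem isNilpotent (h : IsFiliformFrame G N n m x y) : G.IsNilpotent N := by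
  refine ⟨n + m, le_bot_iff.1 (h.flag_eq_bot ▸ ?_)⟩
  generalize n + m = k
  induction k with
  | zero => exact h.flag_zero.ge
  | succ k ih =>
    exact (G.commutator_mono ih le_rfl).trans
      (G.commutator_le.2 fun a ha u hu => h.bracket_flag_mem ha hu)

/-- An even element of weights `0` acts nilpotently along the flag, so that `N + ℂ z` is a
nilpotent ideal. -/
theorem mem_of_weights_zero (h : IsFiliformFrame G N n m x y) (hN : G.IsNilradical N)
    (hsq : G.square ≤ N) {z : V} (hz : HasWeights G x y z 0 0 0) : z ∈ N := by
  suffices hS : G.IsNilpotent (N ⊔ ℂ ∙ z) from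
    hN.le_of_isNilpotent _ (hN.isIdeal.sup_span_singleton hsq hz.even) hS
      (Submodule.mem_sup_right (Submodule.mem_span_singleton_self z))
  -- The extra step leads from `N + ℂ z` into `N`.
  refine ⟨n + m + 1, le_bot_iff.1 (h.flag_eq_bot ▸ ?_)⟩
  generalize n + m = k
  induction k with
  | zero => exact h.flag_zero.symm ▸ (G.commutator_mono le_top le_top).trans hsq
  | succ k ih =>
    refine (G.commutator_mono ih le_rfl).trans (G.commutator_le.2 fun a ha s hs => ?_)
    obtain ⟨u, hu, _, hz', rfl⟩ := Submodule.mem_sup.1 hs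
    obtain ⟨c, rfl⟩ := Submodule.mem_span_singleton.1 hz'
    rw [map_add, map_smul]
    exact add_mem (h.bracket_flag_mem ha hu)
      (Submodule.smul_mem _ _ (h.bracket_flag_mem_of_weights_zero hz ha))

/-- If the line of `x 1` modulo `tailSpan x 2` is preserved by all even elements, the weights are
given by a linear map, whose kernel is the nilradical. -/
theorem exists_weightMap (h : IsFiliformFrame G N n m x y) (hn : 2 ≤ n) (hm : 1 ≤ m)
    (hN : G.IsNilradical N) (hsq : G.square ≤ N)
    (hx : ∀ z ∈ G.part 0, G.bracket z (x 1) ∈ tailSpan x 1) :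
    ∃ W : V →ₗ[ℂ] (Fin 3 → ℂ), LinearMap.ker W = N ∧
      ∀ z ∈ G.part 0, HasWeights G x y z (W z 0) (W z 1) (W z 2) := by
  obtain ⟨f₀, h₀, h₀x, h₀y⟩ := h.exists_dual_x (k := 0) (by omega)
  obtain ⟨f₁, h₁, h₁x, h₁y⟩ := h.exists_dual_x (k := 1) (by omega)
  obtain ⟨g, hg, hgx, hgy⟩ := h.exists_dual_y (k := 0) (by omega)
  have k₀ : flag x y 1 ≤ LinearMap.ker f₀ :=
    flag_le.2 ⟨fun i hi => h₀x i (by omega), fun i _ => h₀y i⟩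
  have k₁ : tailSpan x 2 ≤ LinearMap.ker f₁ := tailSpan_le.2 fun i hi => h₁x i (by omega)
  have kg : flag x y 1 ≤ LinearMap.ker g :=
    flag_le.2 ⟨fun i _ => hgx i, fun i hi => hgy i (by omega)⟩
  have hsq' (a b : V) : G.bracket a b ∈ N := hsq (G.bracket_mem_commutator trivial trivial)
  let W : V →ₗ[ℂ] (Fin 3 → ℂ) := LinearMap.pi ![f₀ ∘ₗ G.bracket.flip (x 0),
    f₁ ∘ₗ G.bracket.flip (x 1), g ∘ₗ G.bracket.flip (y 0)]
  have hW (z : V) (hz : z ∈ G.part 0) : HasWeights G x y z (W z 0) (W z 1) (W z 2) := by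
    refine ⟨hz, ?_, ?_, ?_⟩
    · obtain ⟨c, hc⟩ := exists_sub_smul_mem_tailSpan
        (h.mem_tailSpan_x (hsq' z (x 0)) (G.bracket_mem 0 0 z hz _ (h.x_mem 0)))
      have hk := k₀ (tailSpan_le_flag_left x y 1 hc)
      rw [LinearMap.mem_ker, map_sub, map_smul, h₀, smul_eq_mul, mul_one, sub_eq_zero] at hk
      exact (show W z 0 = c from hk) ▸ hc
    · obtain ⟨c, hc⟩ := exists_sub_smul_mem_tailSpan (hx z hz)
      have hk := k₁ hc
      rw [LinearMap.mem_ker, map_sub, map_smul, h₁, smul_eq_mul, mul_one, sub_eq_zero] at hk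
      exact (show W z 1 = c from hk) ▸ hc
    · obtain ⟨c, hc⟩ := exists_sub_smul_mem_tailSpan
        (h.mem_tailSpan_y (hsq' z (y 0)) (G.bracket_mem 0 1 z hz _ (h.y_mem 0)))
      have hk := kg (tailSpan_le_flag_right x y 1 hc)
      rw [LinearMap.mem_ker, map_sub, map_smul, hg, smul_eq_mul, mul_one, sub_eq_zero] at hk
      exact (show W z 2 = c from hk) ▸ hc
  have hWN (z : V) (hz : z ∈ N) : W z = 0 := by
    have hzF : z ∈ flag x y 0 := h.flag_zero.symm ▸ hz
    funext i
    fin_cases i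
    · have hx0 : x 0 ∈ N := (h.tailSpan_x_le 0 (mem_tailSpan le_rfl)).1
      exact k₀ (h.bracket_flag_mem hzF hx0)
    · obtain ⟨u, hu, v, hv, rfl⟩ := h.exists_add_of_mem hz
      have e : G.bracket (u + v) (x 1) = G.bracket u (x 1) := by
        rw [map_add, LinearMap.add_apply, ← neg_neg (G.bracket v (x 1)),
          ← G.bracket_swap_of_even (h.x_mem 1),
          h.bracket_x_y_eq_zero (mem_tailSpan le_rfl) hv, neg_zero, add_zero]
      have := k₁ (h.bracket_x_mem hu 1)
      rw [← e] at this
      exact this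
    · have hy0 : y 0 ∈ N := (h.tailSpan_y_le 0 (mem_tailSpan le_rfl)).1
      exact kg (h.bracket_flag_mem hzF hy0)
  refine ⟨W, le_antisymm (fun z hz => ?_) hWN, hW⟩
  obtain ⟨a, ha, b, hb, rfl⟩ := G.exists_even_add_odd z
  have hb' := hN.odd_le hsq hb
  rw [LinearMap.mem_ker, map_add, hWN b hb', add_zero] at hz
  have haw := hW a ha
  rw [hz] at haw
  exact add_mem (h.mem_of_weights_zero hN hsq haw) hb'

end IsFiliformFrame

end Frame

end LieSuperalgebra

/-! ### Preserving the line of the second even generator -/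

namespace LieSuperalgebra

section AdaptedFrame

variable {V : Type*} [AddCommGroup V] [Module ℂ V]

namespace IsFiliformFrame

variable {G : LieSuperalgebra V} {N : Submodule ℂ V} {n m : ℕ} {x y : ℕ → V}

/-- Applying an even `z` to `[x 1, y 0] = 0` or `[x 1, x 2] = 0` shows that `[z, x 1]` has no
component along `x 0`, as soon as `y 1 ≠ 0` or `x 3 ≠ 0`. -/
theorem bracket_x_one_mem (h : IsFiliformFrame G N n m x y) (hsq : G.square ≤ N)
    (hnm : 4 ≤ n ∨ 2 ≤ m) {z : V} (hz : z ∈ G.part 0) :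
    G.bracket z (x 1) ∈ tailSpan x 1 := by
  have hsq' (a b : V) : G.bracket a b ∈ N := hsq (G.bracket_mem_commutator trivial trivial)
  have hx (k : ℕ) : G.bracket z (x k) ∈ tailSpan x 0 :=
    h.mem_tailSpan_x (hsq' z (x k)) (G.bracket_mem 0 0 z hz _ (h.x_mem k))
  obtain ⟨c, hc⟩ := exists_sub_smul_mem_tailSpan (hx 1)
  suffices hc0 : c = 0 by rwa [hc0, zero_smul, sub_zero] at hc
  have hx1 : x 1 ∈ tailSpan x 1 := mem_tailSpan le_rfl
  rcases hnm with hn | hm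
  · have hx2 : G.bracket z (x 2) ∈ tailSpan x 1 := by
      rw [← h.bracket_zero_x 0, G.leibniz_of_even hz (h.x_mem 0)]
      exact tailSpan_anti one_le_two (add_mem (h.bracket_x_x_mem (hx 0) (mem_tailSpan zero_le_one))
        (h.bracket_x_x_mem (mem_tailSpan le_rfl) (hx 1)))
    have hL := G.leibniz_of_even hz (h.x_mem 1) (x 2)
    have h₁ := h.bracket_x_x_eq_zero hc (mem_tailSpan one_le_two)
    rw [map_sub, LinearMap.sub_apply, map_smul, LinearMap.smul_apply,
      show G.bracket (x 0) (x 2) = x 3 from h.bracket_zero_x 1,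
      sub_eq_zero] at h₁
    rw [show G.bracket (x 1) (x 2) = 0 from h.bracket_succ_x 0 1, map_zero, h₁,
      h.bracket_x_x_eq_zero hx1 hx2, add_zero] at hL
    obtain ⟨f, hf, -⟩ := h.exists_dual_x (k := 3) (by omega)
    simpa [hf] using (congrArg f hL).symm
  · have hy : G.bracket z (y 0) ∈ tailSpan y 0 :=
      h.mem_tailSpan_y (hsq' z (y 0)) (G.bracket_mem 0 1 z hz _ (h.y_mem 0))
    have hL := G.leibniz_of_even hz (h.x_mem 1) (y 0)
    have h₁ := h.bracket_x_y_eq_zero hc (mem_tailSpan le_rfl)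
    rw [map_sub, LinearMap.sub_apply, map_smul, LinearMap.smul_apply, h.bracket_zero_y 0,
      sub_eq_zero] at h₁
    rw [h.bracket_succ_y 0 0, map_zero, h₁, h.bracket_x_y_eq_zero hx1 hy, add_zero] at hL
    obtain ⟨f, hf, -⟩ := h.exists_dual_y (k := 1) (by omega)
    simpa [hf] using (congrArg f hL).symm

/-- A unimodular change of the two even generators gives another frame of `L^{2,1}` or of
`L^{3,1}`. -/
theorem change_generators (h : IsFiliformFrame G N n 1 x y) (hn : n ∈ Set.Icc 2 3)
    {p q p' q' : ℂ} (hdet : p' * q - q' * p = 1) :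
    IsFiliformFrame G N n 1
      (fun | 0 => p' • x 0 + q' • x 1 | 1 => p • x 0 + q • x 1 | k + 2 => x (k + 2)) y := by
  obtain ⟨hn₂, hn₃⟩ := hn
  set x' : ℕ → V :=
    fun | 0 => p' • x 0 + q' • x 1 | 1 => p • x 0 + q • x 1 | k + 2 => x (k + 2) with hx'
  have e0 : x' 0 = p' • x 0 + q' • x 1 := rfl
  have e1 : x' 1 = p • x 0 + q • x 1 := rfl
  have e2 (k : ℕ) : x' (k + 2) = x (k + 2) := rfl
  have h00 := G.bracket_self_of_even (h.x_mem 0)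
  have h01 := h.bracket_zero_x 0
  have h10 := G.bracket_swap_of_even (h.x_mem 1) (x 0)
  have h11 := h.bracket_succ_x 0 0
  have hx3 (k : ℕ) : x (k + 3) = 0 := h.x_eq_zero _ (by omega)
  have hy1 (k : ℕ) : y (k + 1) = 0 := h.y_eq_zero _ (by omega)
  simp only [zero_add] at h01 h10 h11
  refine ⟨?_, h.y_mem, ?_, h.y_eq_zero, ?_, ?_, ?_, ?_, h.bracket_y_y, ?_, h.finrank_eq⟩
  · rintro (_ | _ | k)
    · exact add_mem (Submodule.smul_mem _ _ (h.x_mem 0)) (Submodule.smul_mem _ _ (h.x_mem 1))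
    · exact add_mem (Submodule.smul_mem _ _ (h.x_mem 0)) (Submodule.smul_mem _ _ (h.x_mem 1))
    · exact h.x_mem _
  · intro k hk
    obtain ⟨k, rfl⟩ := Nat.exists_eq_add_of_le' (hn₂.trans hk)
    exact h.x_eq_zero _ hk
  · rintro (_ | k)
    · rw [e0, zero_add, e1, e2]
      simp only [map_add, map_smul, LinearMap.add_apply, LinearMap.smul_apply, h00, h01, h10, h11]
      linear_combination (norm := module) hdet • x (0 + 2)
    · rw [e0, e2, show k + 1 + 2 = (k + 1) + 2 from rfl, e2]
      have h₁ := h.bracket_zero_x (k + 1)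
      have h₂ := h.bracket_succ_x 0 (k + 1)
      simp only [zero_add] at h₂
      simp only [map_add, map_smul, LinearMap.add_apply, LinearMap.smul_apply, h₁, h₂, hx3,
        smul_zero, add_zero]
  · intro k
    have h₂ := h.bracket_succ_y 0 k
    simp only [zero_add] at h₂
    rw [e0]
    simp only [map_add, map_smul, LinearMap.add_apply, LinearMap.smul_apply, h₂,
      h.bracket_zero_y, hy1, smul_zero, add_zero]
  · have hs (k : ℕ) : G.bracket (x' 1) (x (k + 2)) = 0 := by
      have h₁ := h.bracket_zero_x (k + 1)
      have h₂ := h.bracket_succ_x 0 (k + 1)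
      simp only [zero_add] at h₂
      rw [e1]
      simp only [map_add, map_smul, LinearMap.add_apply, LinearMap.smul_apply, h₁, h₂, hx3,
        smul_zero, add_zero]
    have hx1 : x' 1 ∈ G.part 0 :=
      add_mem (Submodule.smul_mem _ _ (h.x_mem 0)) (Submodule.smul_mem _ _ (h.x_mem 1))
    rintro (_ | i) (_ | j)
    · exact G.bracket_self_of_even hx1
    · exact hs j
    · rw [e2, zero_add, G.bracket_swap_of_even (h.x_mem _), hs, neg_zero]
    · exact h.bracket_succ_x (i + 1) (j + 1)
  · rintro (_ | i) j
    · have h₂ := h.bracket_succ_y 0 j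
      simp only [zero_add] at h₂ ⊢
      rw [e1]
      simp only [map_add, map_smul, LinearMap.add_apply, LinearMap.smul_apply, h₂,
        h.bracket_zero_y, hy1, smul_zero, add_zero]
    · exact h.bracket_succ_y (i + 1) j
  · rw [← h.sup_eq]
    congr 1
    apply le_antisymm
    · have m0 : x 0 ∈ tailSpan x 0 := mem_tailSpan le_rfl
      have m1 : x 1 ∈ tailSpan x 0 := mem_tailSpan zero_le_one
      refine tailSpan_le.2 ?_
      rintro (_ | _ | k) -
      · exact add_mem (Submodule.smul_mem _ _ m0) (Submodule.smul_mem _ _ m1)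
      · exact add_mem (Submodule.smul_mem _ _ m0) (Submodule.smul_mem _ _ m1)
      · exact mem_tailSpan (Nat.zero_le _)
    · have m0 : x' 0 ∈ tailSpan x' 0 := mem_tailSpan le_rfl
      have m1 : x' 1 ∈ tailSpan x' 0 := mem_tailSpan zero_le_one
      refine tailSpan_le.2 ?_
      rintro (_ | _ | k) -
      · have : x 0 = q • x' 0 + (-q') • x' 1 := by
          rw [e0, e1]
          linear_combination (norm := module) hdet • (-x 0)
        rw [this]
        exact add_mem (Submodule.smul_mem _ _ m0) (Submodule.smul_mem _ _ m1)
      · have : x 1 = (-p) • x' 0 + p' • x' 1 := by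
          rw [e0, e1]
          linear_combination (norm := module) hdet • (-x 1)
        rw [zero_add, this]
        exact add_mem (Submodule.smul_mem _ _ m0) (Submodule.smul_mem _ _ m1)
      · exact mem_tailSpan (k := 0) (e := x') (i := k + 2) (Nat.zero_le _)

theorem bracket_tailSpan_two_mem (h : IsFiliformFrame G N n m x y) (hsq : G.square ≤ N) {z u : V}
    (hz : z ∈ G.part 0) (hu : u ∈ tailSpan x 2) : G.bracket z u ∈ tailSpan x 2 := by
  have hx (k : ℕ) : G.bracket z (x k) ∈ tailSpan x 0 :=
    h.mem_tailSpan_x (hsq (G.bracket_mem_commutator trivial trivial))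
      (G.bracket_mem 0 0 z hz _ (h.x_mem k))
  refine map_mem_tailSpan (fun i hi => ?_) hu
  obtain ⟨i, rfl⟩ := Nat.exists_eq_add_of_le' hi
  rw [← h.bracket_zero_x, G.leibniz_of_even hz (h.x_mem 0)]
  exact add_mem (h.bracket_x_x_mem (hx 0) (mem_tailSpan (Nat.zero_le _)))
    (h.bracket_x_x_mem (mem_tailSpan le_rfl) (hx _))

/-- The even elements have a common eigenvector in the span of `x 0` and `x 1` modulo
`tailSpan x 2`: their actions there commute, because their brackets lie in `N`. -/
theorem exists_common_eigenvector (h : IsFiliformFrame G N n m x y) (hn : 2 ≤ n)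
    (hsq : G.square ≤ N) : ∃ p q : ℂ, (p ≠ 0 ∨ q ≠ 0) ∧ ∀ z ∈ G.part 0, ∃ μ : ℂ,
      G.bracket z (p • x 0 + q • x 1) - μ • (p • x 0 + q • x 1) ∈ tailSpan x 2 := by
  obtain ⟨f₀, h₀, h₀x, -⟩ := h.exists_dual_x (k := 0) (by omega)
  obtain ⟨f₁, h₁, h₁x, -⟩ := h.exists_dual_x (k := 1) (by omega)
  have k₀ : tailSpan x 2 ≤ LinearMap.ker f₀ := tailSpan_le.2 fun i hi => h₀x i (by omega)
  have k₁ : tailSpan x 2 ≤ LinearMap.ker f₁ := tailSpan_le.2 fun i hi => h₁x i (by omega)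
  have hmem (z : V) (hz : z ∈ G.part 0) (k : ℕ) : G.bracket z (x k) ∈ tailSpan x 0 :=
    h.mem_tailSpan_x (hsq (G.bracket_mem_commutator trivial trivial))
      (G.bracket_mem 0 0 z hz _ (h.x_mem k))
  have hdec (u : V) (hu : u ∈ tailSpan x 0) :
      u - (f₀ u • x 0 + f₁ u • x 1) ∈ tailSpan x 2 := by
    obtain ⟨a, ha⟩ := exists_sub_smul_mem_tailSpan hu
    obtain ⟨b, hb⟩ := exists_sub_smul_mem_tailSpan ha
    have ea : f₀ u = a := by
      have := k₀ hb
      simpa [h₀, h₀x 1, sub_eq_zero] using this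
    have eb : f₁ u = b := by
      have := k₁ hb
      simpa [h₁, h₁x 0, sub_eq_zero] using this
    rwa [ea, eb, ← sub_sub]
  have hdec' (z w : V) (hz : z ∈ G.part 0) (hw : w ∈ G.part 0) (k : ℕ) :
      G.bracket z (G.bracket w (x k)) - (f₀ (G.bracket w (x k)) • G.bracket z (x 0)
        + f₁ (G.bracket w (x k)) • G.bracket z (x 1)) ∈ tailSpan x 2 := by
    simpa using h.bracket_tailSpan_two_mem hsq hz (hdec _ (hmem w hw k))
  have hcomm (z w : V) (hz : z ∈ G.part 0) (hw : w ∈ G.part 0) (k : ℕ) :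
      (f₀ (G.bracket w (x k)) • G.bracket z (x 0) + f₁ (G.bracket w (x k)) • G.bracket z (x 1))
      - (f₀ (G.bracket z (x k)) • G.bracket w (x 0) + f₁ (G.bracket z (x k)) • G.bracket w (x 1))
        ∈ tailSpan x 2 := by
    have hzw : G.bracket (G.bracket z w) (x k) ∈ tailSpan x 2 :=
      h.bracket_x_x_mem (h.mem_tailSpan_x (hsq (G.bracket_mem_commutator trivial trivial))
        (G.bracket_mem 0 0 z hz w hw)) (mem_tailSpan (Nat.zero_le k))
    have := add_mem (sub_mem (hdec' w z hw hz k) (hdec' z w hz hw k)) hzw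
    convert this using 1
    rw [G.leibniz_of_even hz hw]
    abel
  let M (z : V) : Matrix (Fin 2) (Fin 2) ℂ :=
    !![f₀ (G.bracket z (x 0)), f₀ (G.bracket z (x 1));
      f₁ (G.bracket z (x 0)), f₁ (G.bracket z (x 1))]
  obtain ⟨v, hv, hM⟩ := _root_.exists_common_eigenvector (M '' (G.part 0)) (by
    rintro _ ⟨z, hz, rfl⟩ _ ⟨w, hw, rfl⟩
    have c00 := k₀ (hcomm z w hz hw 0)
    have c01 := k₀ (hcomm z w hz hw 1)
    have c10 := k₁ (hcomm z w hz hw 0)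
    have c11 := k₁ (hcomm z w hz hw 1)
    simp only [LinearMap.mem_ker, map_sub, map_add, map_smul, smul_eq_mul] at c00 c01 c10 c11
    simp only [M, Matrix.mul_fin_two]
    congr 1
    ext i j
    fin_cases i <;> fin_cases j <;> simp
    · linear_combination c00
    · linear_combination c01
    · linear_combination c10
    · linear_combination c11)
  refine ⟨v 0, v 1, ?_, fun z hz => ?_⟩
  · by_contra! h0
    exact hv (funext fun i => by fin_cases i; exacts [h0.1, h0.2])
  · obtain ⟨μ, hμ⟩ := hM _ ⟨z, hz, rfl⟩
    have e0 := congrFun hμ 0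
    have e1 := congrFun hμ 1
    simp only [M, Matrix.mulVec, dotProduct, Fin.sum_univ_two, Matrix.of_apply,
      Matrix.cons_val_zero, Matrix.cons_val_one, Pi.smul_apply, smul_eq_mul,
      Matrix.cons_val_fin_one] at e0 e1
    refine ⟨μ, ?_⟩
    have := hdec (G.bracket z (v 0 • x 0 + v 1 • x 1)) (by
      rw [map_add, map_smul, map_smul]
      exact add_mem (Submodule.smul_mem _ _ (hmem z hz 0)) (Submodule.smul_mem _ _ (hmem z hz 1)))
    convert this using 2
    simp only [map_add, map_smul, smul_eq_mul]
    rw [mul_comm (v 0), mul_comm (v 1), e0, mul_comm (v 0), mul_comm (v 1), e1]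
    module

/-- The nilradical has a filiform frame whose line of `x 1` modulo `tailSpan x 2` is preserved by
all even elements. -/
theorem exists_adapted (h : IsFiliformFrame G N n m x y) (hn : 2 ≤ n) (hm : 1 ≤ m)
    (hsq : G.square ≤ N) : ∃ x' : ℕ → V, IsFiliformFrame G N n m x' y ∧
      ∀ z ∈ G.part 0, G.bracket z (x' 1) ∈ tailSpan x' 1 := by
  by_cases hnm : 4 ≤ n ∨ 2 ≤ m
  · exact ⟨x, h, fun z hz => h.bracket_x_one_mem hsq hnm hz⟩
  obtain rfl : m = 1 := by omega
  obtain ⟨p, q, hpq, hev⟩ := h.exists_common_eigenvector hn hsq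
  obtain ⟨p', q', hdet⟩ : ∃ p' q' : ℂ, p' * q - q' * p = 1 := by
    rcases hpq with hp | hq
    · exact ⟨0, -p⁻¹, by field_simp; ring⟩
    · exact ⟨q⁻¹, 0, by field_simp; ring⟩
  refine ⟨_, h.change_generators ⟨hn, by omega⟩ hdet, fun z hz => ?_⟩
  obtain ⟨μ, hμ⟩ := hev z hz
  refine mem_tailSpan_of_sub (c := μ) ((tailSpan_le.2 fun i hi => ?_ : tailSpan x 2 ≤ _) hμ)
  obtain ⟨i, rfl⟩ := Nat.exists_eq_add_of_le' hi
  exact Submodule.subset_span ⟨i + 2, by simp, rfl⟩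

end IsFiliformFrame

end AdaptedFrame

end LieSuperalgebra

/-! ### Isomorphisms from multiplication tables -/

namespace LieSuperalgebra

section Table

variable {V : Type*} [AddCommGroup V] [Module ℂ V]

/-- A homogeneous basis with the multiplication table `c` gives an isomorphism with the Lie
superalgebra of that table. -/
theorem isIsomorphic_ofTable (G : LieSuperalgebra V) {ι : Type*} {p : ι → ZMod 2}
    {c : ι → ι → ι →₀ ℂ} {mem skew jacobi} (b : Module.Basis ι ℂ V) (hp : ∀ s, b s ∈ G.part (p s))
    (hc : ∀ s t, G.bracket (b s) (b t) = Finsupp.linearCombination ℂ b (c s t)) :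
    G.IsIsomorphic (ofTable p c mem skew jacobi) := by
  have hle (i : ZMod 2) (u : ι →₀ ℂ) (hu : u ∈ tablePart p i) : b.repr.symm u ∈ G.part i := by
    refine tablePart_induction (P := fun u => b.repr.symm u ∈ G.part i) (by simp) ?_ ?_ ?_ u hu
    · intro u v hu hv
      rw [map_add]
      exact add_mem hu hv
    · intro r u hu
      rw [map_smul]
      exact Submodule.smul_mem _ r hu
    · rintro s rfl
      simpa using hp s
  have hge (i : ZMod 2) (v : V) (hv : v ∈ G.part i) : b.repr v ∈ tablePart p i := by
    obtain ⟨u₀, h₀, u₁, h₁, hu⟩ := (ofTable p c mem skew jacobi).exists_even_add_odd (b.repr v)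
    have hv' : v = b.repr.symm u₀ + b.repr.symm u₁ := by
      rw [← map_add, hu, LinearEquiv.symm_apply_apply]
    have hdis := Submodule.disjoint_def.1 G.isCompl.disjoint
    rcases eq_zero_or_eq_one_of_parity i with rfl | rfl
    · have hz : b.repr.symm u₁ = 0 := by
        refine hdis _ ?_ (hle 1 _ h₁)
        rw [← add_sub_cancel_left (b.repr.symm u₀) (b.repr.symm u₁), ← hv']
        exact sub_mem hv (hle 0 _ h₀)
      rw [← hu, (LinearEquiv.map_eq_zero_iff _).1 hz, add_zero]
      exact h₀
    · have hz : b.repr.symm u₀ = 0 := by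
        refine hdis _ (hle 0 _ h₀) ?_
        rw [← add_sub_cancel_right (b.repr.symm u₀) (b.repr.symm u₁), ← hv']
        exact sub_mem hv (hle 1 _ h₁)
      rw [← hu, (LinearEquiv.map_eq_zero_iff _).1 hz, zero_add]
      exact h₁
  refine ⟨b.repr, fun i => ?_, ?_⟩
  · refine le_antisymm (Submodule.map_le_iff_le_comap.2 fun v hv => hge i v hv) fun u hu => ?_
    exact ⟨b.repr.symm u, hle i u hu, b.repr.apply_symm_apply u⟩
  · have key : G.bracket.compr₂ b.repr.toLinearMap
        = (tableBracket c).compl₁₂ b.repr.toLinearMap b.repr.toLinearMap := by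
      refine b.ext fun s => b.ext fun t => ?_
      simp [hc, tableBracket_single, ← Module.Basis.repr_symm_apply]
    exact fun u v => LinearMap.congr_fun₂ key u v

end Table

namespace FiliformIndex

/-- The labels of the basis of `L^{n,m}` as a disjoint union. -/
def equivSum (n m : ℕ) : FiliformIndex n m ≃ Fin n ⊕ Fin m where
  toFun
    | x i => Sum.inl i
    | y j => Sum.inr j
  invFun := Sum.elim x y
  left_inv := by rintro (_ | _) <;> rfl
  right_inv := by rintro (_ | _) <;> rfl

instance (n m : ℕ) : Fintype (FiliformIndex n m) := Fintype.ofEquiv _ (equivSum n m).symm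

theorem card_eq (n m : ℕ) : Fintype.card (FiliformIndex n m) = n + m := by
  rw [Fintype.card_congr (equivSum n m)]
  simp

end FiliformIndex

namespace SolvableIndex

/-- The labels of the basis of `SL^{n,m}` as a disjoint union. -/
def equivSum (n m : ℕ) : SolvableIndex n m ≃ Fin n ⊕ Fin 3 ⊕ Fin m where
  toFun
    | x i => Sum.inl i
    | t k => Sum.inr (Sum.inl k)
    | y j => Sum.inr (Sum.inr j)
  invFun := Sum.elim x (Sum.elim t y)
  left_inv := by rintro (_ | _ | _) <;> rfl
  right_inv := by rintro (_ | _ | _) <;> rfl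

instance (n m : ℕ) : Fintype (SolvableIndex n m) := Fintype.ofEquiv _ (equivSum n m).symm

theorem card_eq (n m : ℕ) : Fintype.card (SolvableIndex n m) = n + m + 3 := by
  rw [Fintype.card_congr (equivSum n m)]
  simp
  ring

end SolvableIndex

section Frame

variable {V : Type*} [AddCommGroup V] [Module ℂ V] {G : LieSuperalgebra V} {N : Submodule ℂ V}
  {n m : ℕ} {x y : ℕ → V}

open FiliformIndex in
/-- The basis vectors of `L^{n,m}` form a frame of any ideal isomorphic to it. -/
theorem exists_isFiliformFrame (hn : 2 ≤ n) (hI : G.IsIdeal N)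
    (hiso : (G.restrict N hI).IsIsomorphic (modelFiliform n m)) :
    ∃ x y, IsFiliformFrame G N n m x y := by
  obtain ⟨e, hpart, hbr⟩ := hiso
  have hmem (i : ZMod 2) {u : FiliformIndex n m →₀ ℂ} (hu : u ∈ tablePart parity i) :
      (e.symm u : V) ∈ G.part i := by
    have hu' : u ∈ (modelFiliform n m).part i := hu
    rw [← hpart i] at hu'
    obtain ⟨v, hv, rfl⟩ := hu'
    rw [LinearEquiv.coe_coe, LinearEquiv.symm_apply_apply]
    exact hv
  have hbr' (u v : FiliformIndex n m →₀ ℂ) :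
      G.bracket (e.symm u) (e.symm v) = e.symm (tableBracket table u v) := by
    have h := hbr (e.symm u) (e.symm v)
    rw [LinearEquiv.apply_symm_apply, LinearEquiv.apply_symm_apply] at h
    rw [show tableBracket table u v = e ((G.restrict N hI).bracket (e.symm u) (e.symm v)) from
      h.symm, LinearEquiv.symm_apply_apply]
    rfl
  have hx0 : xVec n m 0 = Finsupp.single (x ⟨0, by omega⟩) 1 := dif_pos _
  have hxz (k : ℕ) (hk : n ≤ k) : xVec n m k = 0 := dif_neg (not_lt.2 hk)
  have hyz (k : ℕ) (hk : m ≤ k) : yVec n m k = 0 := dif_neg (not_lt.2 hk)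
  have hxs (i : ℕ) (hi : i < n) : xVec n m i = Finsupp.single (x ⟨i, hi⟩) 1 := dif_pos hi
  have hys (i : ℕ) (hi : i < m) : yVec n m i = Finsupp.single (y ⟨i, hi⟩) 1 := dif_pos hi
  refine ⟨fun k => e.symm (xVec n m k), fun k => e.symm (yVec n m k),
    fun k => hmem 0 (xVec_mem k), fun k => hmem 1 (yVec_mem k), fun k hk => by simp [hxz k hk],
    fun k hk => by simp [hyz k hk], fun k => ?_, fun k => ?_, fun i j => ?_, fun i j => ?_,
    fun i j => ?_, ?_, ?_⟩
  · rw [hbr', hx0, bracket_x_x, if_pos rfl]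
  · rw [hbr', hx0]
    by_cases hk : k < m
    · rw [hys k hk, tableBracket_single]
      simp [table]
    · rw [hyz k (not_lt.1 hk), hyz (k + 1) (by omega), map_zero]
  · rw [hbr']
    by_cases hi : i + 1 < n
    · rw [hxs _ hi, bracket_x_x, if_neg (by simp)]
      simp
    · rw [hxz _ (not_lt.1 hi)]
      simp
  · rw [hbr']
    by_cases hi : i + 1 < n
    · by_cases hj : j < m
      · rw [hxs _ hi, hys j hj, tableBracket_single]
        simp [table]
      · rw [hyz j (not_lt.1 hj)]
        simp
    · rw [hxz _ (not_lt.1 hi)]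
      simp
  · rw [hbr']
    by_cases hi : i < m
    · rw [hys _ hi, bracket_y_y]
      simp
    · rw [hyz _ (not_lt.1 hi)]
      simp
  · apply le_antisymm
    · exact sup_le (tailSpan_le.2 fun i _ => (e.symm _).2) (tailSpan_le.2 fun i _ => (e.symm _).2)
    · intro v hv
      obtain ⟨u, hu⟩ := e.symm.surjective ⟨v, hv⟩
      obtain rfl : (e.symm u : V) = v := congrArg Subtype.val hu
      have hspan : (⊤ : Submodule ℂ (FiliformIndex n m →₀ ℂ)) ≤
          (flag (fun k => (e.symm (xVec n m k) : V)) (fun k => e.symm (yVec n m k)) 0).comap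
            (N.subtype ∘ₗ e.symm.toLinearMap) := by
        rw [← (Finsupp.basisSingleOne (R := ℂ)).span_eq, Submodule.span_le]
        rintro _ ⟨i | j, rfl⟩
        · simp only [Finsupp.coe_basisSingleOne]
          rw [← hxs i i.2]
          exact tailSpan_le_flag_left _ _ 0 (Submodule.subset_span ⟨i, by simp, rfl⟩)
        · simp only [Finsupp.coe_basisSingleOne]
          rw [← hys j j.2]
          exact tailSpan_le_flag_right _ _ 0 (Submodule.subset_span ⟨j, by simp, rfl⟩)
      exact hspan trivial
  · rw [LinearEquiv.finrank_eq e, Module.finrank_finsupp_self, card_eq]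

open FiliformIndex in
/-- An ideal with a filiform frame is isomorphic to `L^{n,m}`. -/
theorem IsFiliformFrame.restrict_isIsomorphic (h : IsFiliformFrame G N n m x y) (hn : 2 ≤ n)
    (hI : G.IsIdeal N) : (G.restrict N hI).IsIsomorphic (modelFiliform n m) := by
  have hx (k : ℕ) : x k ∈ N := (h.tailSpan_x_le 0 (mem_tailSpan k.zero_le)).1
  have hy (k : ℕ) : y k ∈ N := (h.tailSpan_y_le 0 (mem_tailSpan k.zero_le)).1
  let v : FiliformIndex n m → N
    | .x i => ⟨x i, hx i⟩
    | .y j => ⟨y j, hy j⟩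
  have hv : LinearIndependent ℂ v := by
    apply LinearIndependent.of_comp N.subtype
    convert h.linearIndependent.comp _ (equivSum n m).injective
    funext s
    cases s <;> rfl
  have : Nonempty (FiliformIndex n m) := ⟨.x ⟨0, by omega⟩⟩
  let b := basisOfLinearIndependentOfCardEqFinrank hv (by rw [h.finrank_eq, card_eq])
  have hb (s : FiliformIndex n m) : b s = v s := by simp [b]
  have hbx (k : ℕ) : Finsupp.linearCombination ℂ b (xVec n m k) = ⟨x k, hx k⟩ := by
    by_cases hk : k < n
    · rw [xVec, dif_pos hk, Finsupp.linearCombination_single, one_smul, hb]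
    · rw [xVec, dif_neg hk, map_zero]
      exact Subtype.ext (h.x_eq_zero k (not_lt.1 hk)).symm
  have hby (k : ℕ) : Finsupp.linearCombination ℂ b (yVec n m k) = ⟨y k, hy k⟩ := by
    by_cases hk : k < m
    · rw [yVec, dif_pos hk, Finsupp.linearCombination_single, one_smul, hb]
    · rw [yVec, dif_neg hk, map_zero]
      exact Subtype.ext (h.y_eq_zero k (not_lt.1 hk)).symm
  have swap {a : V} (ha : a ∈ G.part 0) (c : V) : G.bracket c a = -G.bracket a c := by
    rw [G.bracket_swap_of_even ha, neg_neg]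
  refine isIsomorphic_ofTable _ b (fun s => ?_) fun s t => ?_
  · rw [hb]
    cases s
    exacts [h.x_mem _, h.y_mem _]
  · rw [hb, hb]
    apply Subtype.ext
    change G.bracket (v s) (v t) = _
    rcases s with ⟨_ | i, hi⟩ | i <;> rcases t with ⟨_ | j, hj⟩ | j
    · simp [v, table, G.bracket_self_of_even (h.x_mem 0)]
    · simp [v, table, hbx, h.bracket_zero_x]
    · simp [v, table, hby, h.bracket_zero_y]
    · simp [v, table, hbx, G.bracket_swap_of_even (h.x_mem (i + 1)), h.bracket_zero_x]
    · simp [v, table, h.bracket_succ_x]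
    · simp [v, table, h.bracket_succ_y]
    · simp [v, table, hby, swap (h.x_mem 0), h.bracket_zero_y]
    · simp [v, table, swap (h.x_mem (j + 1)), h.bracket_succ_y]
    · simp [v, table, h.bracket_y_y]

open SolvableIndex in
/-- A filiform frame together with commuting even vectors `t 0`, `t 1`, `t 2` that act on it
diagonally with the weights of `SL^{n,m}` and complete it to a basis gives an isomorphism with
`SL^{n,m}`. -/
theorem IsFiliformFrame.isIsomorphic_solvableFiliform (h : IsFiliformFrame G N n m x y)
    (b : Module.Basis (SolvableIndex n m) ℂ V) {t : Fin 3 → V} (hbx : ∀ i, b (.x i) = x i)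
    (hby : ∀ j, b (.y j) = y j) (hbt : ∀ k, b (.t k) = t k) (ht : ∀ k, t k ∈ G.part 0)
    (htt : ∀ k l, G.bracket (t k) (t l) = 0)
    (htx : ∀ k i, G.bracket (t k) (x i) = xWeight k i • x i)
    (hty : ∀ k j, G.bracket (t k) (y j) = yWeight k j • y j) :
    G.IsIsomorphic (solvableFiliform n m) := by
  have hbx' (k : ℕ) : Finsupp.linearCombination ℂ b (xVec n m k) = x k := by
    by_cases hk : k < n
    · rw [xVec, dif_pos hk, Finsupp.linearCombination_single, one_smul, hbx]
    · rw [xVec, dif_neg hk, map_zero, h.x_eq_zero k (not_lt.1 hk)]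
  have hby' (k : ℕ) : Finsupp.linearCombination ℂ b (yVec n m k) = y k := by
    by_cases hk : k < m
    · rw [yVec, dif_pos hk, Finsupp.linearCombination_single, one_smul, hby]
    · rw [yVec, dif_neg hk, map_zero, h.y_eq_zero k (not_lt.1 hk)]
  have swap {a : V} (ha : a ∈ G.part 0) (c : V) : G.bracket c a = -G.bracket a c := by
    rw [G.bracket_swap_of_even ha, neg_neg]
  refine isIsomorphic_ofTable _ b (fun s => ?_) fun s u => ?_
  · cases s
    exacts [hbx _ ▸ h.x_mem _, hbt _ ▸ ht _, hby _ ▸ h.y_mem _]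
  · rcases s with ⟨_ | i, hi⟩ | i | i <;> rcases u with ⟨_ | j, hj⟩ | j | j <;>
      simp only [hbx, hby, hbt]
    · simp [table, G.bracket_self_of_even (h.x_mem 0)]
    · simp [table, hbx', h.bracket_zero_x]
    · simp [table, hbx', htx, swap (ht j)]
    · simp [table, hby', h.bracket_zero_y]
    · simp [table, hbx', G.bracket_swap_of_even (h.x_mem (i + 1)), h.bracket_zero_x]
    · simp [table, h.bracket_succ_x]
    · simp [table, hbx', htx, swap (ht j)]
    · simp [table, h.bracket_succ_y]
    · simp [table, hbx', htx]
    · simp [table, hbx', htx]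
    · simp [table, htt]
    · simp [table, hby', hty]
    · simp [table, hby', swap (h.x_mem 0), h.bracket_zero_y]
    · simp [table, swap (h.x_mem (j + 1)), h.bracket_succ_y]
    · simp [table, hby', swap (ht j), hty]
    · simp [table, h.bracket_y_y]

end Frame

end LieSuperalgebra

/-! ### Maximal codimension -/

namespace LieSuperalgebra

section Classification

variable {V : Type*} [AddCommGroup V] [Module ℂ V] {G : LieSuperalgebra V} {N : Submodule ℂ V}
  {n m : ℕ} {x y : ℕ → V}

theorem evenWeight_xWeight (k : Fin 3) (i : ℕ) :
    evenWeight (SolvableIndex.xWeight k 0) (SolvableIndex.xWeight k 1) i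
      = SolvableIndex.xWeight k i := by
  cases i <;> fin_cases k <;> simp [evenWeight, SolvableIndex.xWeight]
  ring

theorem yWeight_zero_add (k : Fin 3) (j : ℕ) :
    SolvableIndex.yWeight k 0 + j * SolvableIndex.xWeight k 0 = SolvableIndex.yWeight k j := by
  fin_cases k <;> simp [SolvableIndex.xWeight, SolvableIndex.yWeight]
  ring

namespace IsFiliformFrame

/-- An even element `T` of weights `1`, `2`, `1` has simple spectrum on the even and on the odd
part of `N`, and its eigenvectors form a frame. -/
theorem exists_eigenframe (h : IsFiliformFrame G N n m x y) {T : V}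
    (hT : HasWeights G x y T 1 2 1) : ∃ x' y', IsFiliformFrame G N n m x' y' ∧
      (∀ k, x' k - x k ∈ tailSpan x (k + 1)) ∧ (∀ k, y' k - y k ∈ tailSpan y (k + 1)) ∧
      (∀ k : ℕ, G.bracket T (x' k) = ((k : ℂ) + 1) • x' k) ∧
      ∀ k : ℕ, G.bracket T (y' k) = ((k : ℂ) + 1) • y' k := by
  have hDx (i : ℕ) : G.bracket T (x i) - ((i : ℂ) + 1) • x i ∈ tailSpan x (i + 1) := by
    have hi := h.bracket_even_x hT i
    have hw : evenWeight 1 2 i = (i : ℂ) + 1 := by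
      cases i
      · simp [evenWeight]
      · simp [evenWeight]
        ring
    rwa [hw] at hi
  have hDy (i : ℕ) : G.bracket T (y i) - ((i : ℂ) + 1) • y i ∈ tailSpan y (i + 1) := by
    have hi := h.bracket_even_y hT i
    rwa [mul_one, add_comm (1 : ℂ)] at hi
  choose x' hx' hTx using exists_eigenvector_sub_mem_tailSpan h.x_eq_zero hDx
  choose y' hy' hTy using exists_eigenvector_sub_mem_tailSpan h.y_eq_zero hDy
  have mx (k : ℕ) : x' k ∈ tailSpan x k :=
    mem_tailSpan_of_sub (c := 1) (by simpa using hx' k)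
  have my (k : ℕ) : y' k ∈ tailSpan y k :=
    mem_tailSpan_of_sub (c := 1) (by simpa using hy' k)
  have hx'0 (k : ℕ) : x' k ∈ G.part 0 := (h.tailSpan_x_le k (mx k)).2
  refine ⟨x', y', ⟨hx'0, fun k => (h.tailSpan_y_le k (my k)).2, fun k hk => ?_,
    fun k hk => ?_, fun k => ?_, fun k => ?_, fun i j => ?_, fun i j => ?_, fun i j => ?_, ?_,
    h.finrank_eq⟩, hx', hy', hTx, hTy⟩
  · have := mx k
    rwa [tailSpan_eq_bot h.x_eq_zero hk, Submodule.mem_bot] at this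
  · have := my k
    rwa [tailSpan_eq_bot h.y_eq_zero hk, Submodule.mem_bot] at this
  · rw [← sub_eq_zero]
    -- The two sides have the same leading term and the same eigenvalue under `T`.
    refine eq_zero_of_map_eq_smul (k := k + 3) h.x_eq_zero hDx ?_ ?_
    · have e₁ := h.bracket_x_x_eq_zero (hx' 0) (tailSpan_anti (Nat.le_add_left 1 k) (mx (k + 1)))
      have e₂ := h.bracket_zero_mem_x (hx' (k + 1))
      rw [map_sub, LinearMap.sub_apply, sub_eq_zero] at e₁
      rw [map_sub, h.bracket_zero_x] at e₂
      rw [e₁]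
      simpa using sub_mem e₂ (hx' (k + 2))
    · rw [map_sub, G.leibniz_of_even hT.even (hx'0 0), hTx, hTx, hTx]
      simp only [map_smul, LinearMap.smul_apply]
      push_cast
      module
  · rw [← sub_eq_zero]
    refine eq_zero_of_map_eq_smul (k := k + 2) h.y_eq_zero hDy ?_ ?_
    · have e₁ := h.bracket_x_y_eq_zero (hx' 0) (tailSpan_anti (Nat.zero_le k) (my k))
      have e₂ := h.bracket_zero_mem_y (hy' k)
      rw [map_sub, LinearMap.sub_apply, sub_eq_zero] at e₁
      rw [map_sub, h.bracket_zero_y] at e₂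
      rw [e₁]
      simpa using sub_mem e₂ (hy' (k + 1))
    · rw [map_sub, G.leibniz_of_even hT.even (hx'0 0), hTx, hTy, hTy]
      simp only [map_smul, LinearMap.smul_apply]
      push_cast
      module
  · exact h.bracket_x_x_eq_zero (tailSpan_anti (Nat.le_add_left 1 i) (mx (i + 1)))
      (tailSpan_anti (Nat.le_add_left 1 j) (mx (j + 1)))
  · exact h.bracket_x_y_eq_zero (tailSpan_anti (Nat.le_add_left 1 i) (mx (i + 1)))
      (tailSpan_anti (Nat.zero_le j) (my j))
  · exact h.bracket_y_y_eq_zero (tailSpan_anti (Nat.zero_le i) (my i))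
      (tailSpan_anti (Nat.zero_le j) (my j))
  · rw [tailSpan_eq_of_sub_mem h.x_eq_zero hx', tailSpan_eq_of_sub_mem h.y_eq_zero hy', h.sup_eq]

/-- Passing to a frame with the same leading terms does not change the weights. -/
theorem hasWeights_of_sub_mem (h : IsFiliformFrame G N n m x y) {x' y' : ℕ → V}
    (hx' : ∀ k, x' k - x k ∈ tailSpan x (k + 1)) (hy' : ∀ k, y' k - y k ∈ tailSpan y (k + 1))
    {z : V} {α β γ : ℂ} (hz : HasWeights G x y z α β γ) : HasWeights G x' y' z α β γ := by
  have hzx {k : ℕ} {u : V} (hu : u ∈ tailSpan x k) : G.bracket z u ∈ tailSpan x k :=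
    map_mem_tailSpan (fun i hi => tailSpan_anti hi (mem_tailSpan_of_sub (h.bracket_even_x hz i))) hu
  have hzy {k : ℕ} {u : V} (hu : u ∈ tailSpan y k) : G.bracket z u ∈ tailSpan y k :=
    map_mem_tailSpan (fun i hi => tailSpan_anti hi (mem_tailSpan_of_sub (h.bracket_even_y hz i))) hu
  have key (a b : V) (μ : ℂ) : G.bracket z a - μ • a
      = (G.bracket z b - μ • b) + (G.bracket z (a - b) - μ • (a - b)) := by
    rw [map_sub]
    module
  refine ⟨hz.even, ?_, ?_, ?_⟩
  · rw [tailSpan_eq_of_sub_mem h.x_eq_zero hx', key _ (x 0)]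
    exact add_mem hz.x_zero (sub_mem (hzx (hx' 0)) (Submodule.smul_mem _ _ (hx' 0)))
  · rw [tailSpan_eq_of_sub_mem h.x_eq_zero hx', key _ (x 1)]
    exact add_mem hz.x_one (sub_mem (hzx (hx' 1)) (Submodule.smul_mem _ _ (hx' 1)))
  · rw [tailSpan_eq_of_sub_mem h.y_eq_zero hy', key _ (y 0)]
    exact add_mem hz.y_zero (sub_mem (hzy (hy' 0)) (Submodule.smul_mem _ _ (hy' 0)))

/-- If the weights take all values, the algebra is isomorphic to `SL^{n,m}`. With `T` of weights
`1`, `2`, `1`, the even elements commuting with `T` form a complement of `N` that is abelian and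
acts diagonally on the eigenvectors of `T`. -/
theorem isIsomorphic_of_weightMap_surjective (h : IsFiliformFrame G N n m x y)
    (hN : G.IsNilradical N) (hsq : G.square ≤ N) {W : V →ₗ[ℂ] (Fin 3 → ℂ)}
    (hker : LinearMap.ker W = N)
    (hW : ∀ z ∈ G.part 0, HasWeights G x y z (W z 0) (W z 1) (W z 2))
    (hsurj : Function.Surjective W) : G.IsIsomorphic (solvableFiliform n m) := by
  have hsq' (a b : V) : G.bracket a b ∈ N := hsq (G.bracket_mem_commutator trivial trivial)
  have hlift (w : Fin 3 → ℂ) : ∃ z ∈ G.part 0, W z = w := by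
    obtain ⟨z, rfl⟩ := hsurj w
    obtain ⟨a, ha, b, hb, rfl⟩ := G.exists_even_add_odd z
    have hb' : W b = 0 := by
      rw [← LinearMap.mem_ker, hker]
      exact hN.odd_le hsq hb
    exact ⟨a, ha, by rw [map_add, hb', add_zero]⟩
  obtain ⟨T, hT0, hWT⟩ := hlift ![1, 2, 1]
  have hT : HasWeights G x y T 1 2 1 := by simpa [hWT] using hW T hT0
  obtain ⟨x', y', h', hx', hy', hTx, hTy⟩ := h.exists_eigenframe hT
  have hDx (i : ℕ) : G.bracket T (x' i) - ((i : ℂ) + 1) • x' i ∈ tailSpan x' (i + 1) := by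
    rw [hTx, sub_self]
    exact zero_mem _
  have hDy (i : ℕ) : G.bracket T (y' i) - ((i : ℂ) + 1) • y' i ∈ tailSpan y' (i + 1) := by
    rw [hTy, sub_self]
    exact zero_mem _
  -- `ad T` is bijective on the even part of `N`, so any even `z` can be corrected by an element
  -- of `N` to commute with `T`.
  have hcomm (w : Fin 3 → ℂ) : ∃ t ∈ G.part 0, W t = w ∧ G.bracket T t = 0 := by
    obtain ⟨z, hz, rfl⟩ := hlift w
    obtain ⟨u, hu, hTu⟩ := exists_map_sub_smul_eq h'.x_eq_zero hDx
      (h'.mem_tailSpan_x (hsq' T z) (G.bracket_mem 0 0 T hT0 z hz))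
    rw [Nat.cast_zero, zero_smul, sub_zero] at hTu
    have hWu : W u = 0 := by
      rw [← LinearMap.mem_ker, hker]
      exact (h'.tailSpan_x_le 0 hu).1
    exact ⟨z - u, sub_mem hz (h'.tailSpan_x_le 0 hu).2, by rw [map_sub, hWu, sub_zero],
      by rw [map_sub, hTu, sub_self]⟩
  choose τ hτ0 hWτ hTτ using hcomm
  let t (k : Fin 3) : V :=
    τ ![SolvableIndex.xWeight k 0, SolvableIndex.xWeight k 1, SolvableIndex.yWeight k 0]
  have hTt (k : Fin 3) : G.bracket T (t k) = 0 := hTτ _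
  have hwt (k : Fin 3) : HasWeights G x' y' (t k) (SolvableIndex.xWeight k 0)
      (SolvableIndex.xWeight k 1) (SolvableIndex.yWeight k 0) := by
    apply h.hasWeights_of_sub_mem hx' hy'
    have := hW _ (hτ0 ![SolvableIndex.xWeight k 0, SolvableIndex.xWeight k 1,
      SolvableIndex.yWeight k 0])
    rw [hWτ] at this
    exact this
  have htt (k l : Fin 3) : G.bracket (t k) (t l) = 0 := by
    refine eq_zero_of_map_eq_smul (k := 0) h'.x_eq_zero hDx (h'.mem_tailSpan_x (hsq' _ _)
      (G.bracket_mem 0 0 _ (hτ0 _) _ (hτ0 _))) ?_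
    rw [G.leibniz_of_even hT0 (hτ0 _), hTt, hTt]
    simp
  have htx (k : Fin 3) (i : ℕ) : G.bracket (t k) (x' i) = SolvableIndex.xWeight k i • x' i := by
    rw [← sub_eq_zero]
    refine eq_zero_of_map_eq_smul (k := i + 1) h'.x_eq_zero hDx ?_ ?_
    · rw [← evenWeight_xWeight]
      exact h'.bracket_even_x (hwt k) i
    · rw [map_sub, G.leibniz_of_even hT0 (hτ0 _), hTt, map_smul, hTx]
      simp only [map_smul, map_zero, LinearMap.zero_apply]
      push_cast
      module
  have hty (k : Fin 3) (i : ℕ) : G.bracket (t k) (y' i) = SolvableIndex.yWeight k i • y' i := by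
    rw [← sub_eq_zero]
    refine eq_zero_of_map_eq_smul (k := i + 1) h'.y_eq_zero hDy ?_ ?_
    · rw [← yWeight_zero_add]
      exact h'.bracket_even_y (hwt k) i
    · rw [map_sub, G.leibniz_of_even hT0 (hτ0 _), hTt, map_smul, hTy]
      simp only [map_smul, map_zero, LinearMap.zero_apply]
      push_cast
      module
  let v : SolvableIndex n m → V
    | .x i => x' i
    | .t k => t k
    | .y j => y' j
  have hNv : N ≤ Submodule.span ℂ (Set.range v) := by
    rw [← h'.span_eq, Submodule.span_le]
    rintro _ ⟨i | j, rfl⟩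
    · exact Submodule.subset_span ⟨.x i, rfl⟩
    · exact Submodule.subset_span ⟨.y j, rfl⟩
  have hspan : ⊤ ≤ Submodule.span ℂ (Set.range v) := by
    intro z _
    have ht (k : Fin 3) : t k ∈ Submodule.span ℂ (Set.range v) := Submodule.subset_span ⟨.t k, rfl⟩
    -- The coefficients invert the matrix of the weights `(1, 2, 1)`, `(0, 1, 0)`, `(0, 0, 1)`.
    set s := W z 0 • t 0 + (W z 1 - 2 * W z 0) • t 1 + (W z 2 - W z 0) • t 2 with hs
    have hzs : z - s ∈ N := by
      rw [← hker, LinearMap.mem_ker, map_sub, sub_eq_zero, hs]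
      simp only [map_add, map_smul, t, hWτ]
      funext i
      fin_cases i <;> simp [SolvableIndex.xWeight, SolvableIndex.yWeight]
      ring
    rw [← sub_add_cancel z s]
    exact add_mem (hNv hzs) (add_mem (add_mem (Submodule.smul_mem _ _ (ht 0))
      (Submodule.smul_mem _ _ (ht 1))) (Submodule.smul_mem _ _ (ht 2)))
  have hfin : Module.Finite ℂ V :=
    Module.finite_def.2 (Submodule.fg_def.2 ⟨_, Set.finite_range v, top_le_iff.1 hspan⟩)
  have hdim : Fintype.card (SolvableIndex n m) = Module.finrank ℂ V := by
    rw [← LinearMap.finrank_range_add_finrank_ker W, LinearMap.range_eq_top.2 hsurj, hker,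
      h.finrank_eq, SolvableIndex.card_eq, finrank_top, Module.finrank_fin_fun]
    ring
  let b := basisOfTopLeSpanOfCardEqFinrank v hspan hdim
  have hb (s : SolvableIndex n m) : b s = v s := by simp [b]
  exact h'.isIsomorphic_solvableFiliform b (t := t) (fun i => hb _) (fun j => hb _)
    (fun k => hb _) (fun k => hτ0 _) htt htx hty

end IsFiliformFrame

end Classification

end LieSuperalgebra

/-! ### The algebra `SL^{n,m}` -/

namespace LieSuperalgebra

section Model

open SolvableIndex

variable {n m : ℕ}

theorem isFiliformFrame_solvableFiliform (hn : 2 ≤ n) :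
    IsFiliformFrame (solvableFiliform n m) (flag (xVec n m) (yVec n m) 0) n m
      (xVec n m) (yVec n m) := by
  have hxz (k : ℕ) (hk : n ≤ k) : xVec n m k = 0 := dif_neg (not_lt.2 hk)
  have hyz (k : ℕ) (hk : m ≤ k) : yVec n m k = 0 := dif_neg (not_lt.2 hk)
  have hxs (i : ℕ) (hi : i < n) : xVec n m i = Finsupp.single (x ⟨i, hi⟩) 1 := dif_pos hi
  have hys (i : ℕ) (hi : i < m) : yVec n m i = Finsupp.single (y ⟨i, hi⟩) 1 := dif_pos hi
  have hbr : (solvableFiliform n m).bracket = tableBracket table := rfl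
  refine ⟨fun k => xVec_mem k, fun k => yVec_mem k, hxz, hyz, fun k => ?_, fun k => ?_,
    fun i j => ?_, fun i j => ?_, fun i j => ?_, rfl, ?_⟩
  · rw [hbr, hxs 0 (by omega), bracket_x_x, if_pos rfl]
  · by_cases hk : k < m
    · rw [hbr, hxs 0 (by omega), bracket_x_yVec _ ⟨k, hk⟩, if_pos rfl]
    · rw [hyz k (not_lt.1 hk), hyz (k + 1) (by omega), map_zero]
  · by_cases hi : i + 1 < n
    · rw [hbr, hxs _ hi, bracket_x_x, if_neg (by simp)]
    · rw [hxz _ (not_lt.1 hi), map_zero, LinearMap.zero_apply]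
  · by_cases hi : i + 1 < n
    · by_cases hj : j < m
      · rw [hbr, hxs _ hi, bracket_x_yVec _ ⟨j, hj⟩, if_neg (by simp)]
      · rw [hyz j (not_lt.1 hj), map_zero]
    · rw [hxz _ (not_lt.1 hi), map_zero, LinearMap.zero_apply]
  · by_cases hi : i < m
    · rw [hbr, hys _ hi, bracket_y_y]
    · rw [hyz _ (not_lt.1 hi), map_zero, LinearMap.zero_apply]
  · have hli : LinearIndependent ℂ
        (Sum.elim (fun i : Fin n => xVec n m i) fun j : Fin m => yVec n m j) := by
      convert (Finsupp.basisSingleOne (R := ℂ) (ι := SolvableIndex n m)).linearIndependent.comp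
        (Sum.elim x y : Fin n ⊕ Fin m → SolvableIndex n m) ?_ using 1
      · funext s
        rcases s with i | j
        · simp [hxs i i.2]
        · simp [hys j j.2]
      · rintro (_ | _) (_ | _) h <;> simp_all
    rw [← span_range_sumElim_eq_flag hxz hyz, finrank_span_eq_card hli]
    simp

/-- The coordinates along `t 0`, `t 1`, `t 2`. -/
noncomputable def torusCoord (n m : ℕ) : (SolvableIndex n m →₀ ℂ) →ₗ[ℂ] (Fin 3 → ℂ) :=
  LinearMap.pi fun k => Finsupp.lapply (t k)

/-- The combination of `t 0`, `t 1`, `t 2` with given coefficients. -/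
noncomputable def torusVec (n m : ℕ) : (Fin 3 → ℂ) →ₗ[ℂ] (SolvableIndex n m →₀ ℂ) :=
  Fintype.linearCombination ℂ fun k => Finsupp.single (t k) 1

theorem torusVec_apply (c : Fin 3 → ℂ) :
    torusVec n m c = ∑ k, c k • Finsupp.single (t k) 1 :=
  Fintype.linearCombination_apply ..

theorem torusCoord_single_t (k : Fin 3) :
    torusCoord n m (Finsupp.single (t k) 1) = Pi.single k 1 := by
  funext l
  by_cases h : l = k
  · subst h
    simp [torusCoord]
  · simp [torusCoord, h]

theorem torusCoord_torusVec (c : Fin 3 → ℂ) : torusCoord n m (torusVec n m c) = c := by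
  simp only [torusVec_apply, map_sum, map_smul, torusCoord_single_t]
  funext l
  simp [Pi.single_apply]

theorem torusCoord_xVec (k : ℕ) : torusCoord n m (xVec n m k) = 0 := by
  funext l
  unfold xVec
  split_ifs <;> simp [torusCoord]

theorem torusCoord_yVec (k : ℕ) : torusCoord n m (yVec n m k) = 0 := by
  funext l
  unfold yVec
  split_ifs <;> simp [torusCoord]

theorem sub_torusVec_mem_flag (v : SolvableIndex n m →₀ ℂ) :
    v - torusVec n m (torusCoord n m v) ∈ flag (xVec n m) (yVec n m) 0 := by
  induction v using Finsupp.induction_linear with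
  | zero => simp
  | add u v hu hv =>
    convert add_mem hu hv using 1
    rw [map_add, map_add]
    abel
  | single s c =>
    have hs : Finsupp.single s c = c • (Finsupp.single s 1 : SolvableIndex n m →₀ ℂ) := by simp
    suffices H : (Finsupp.single s 1 : SolvableIndex n m →₀ ℂ)
        - torusVec n m (torusCoord n m (Finsupp.single s 1)) ∈ flag (xVec n m) (yVec n m) 0 by
      convert Submodule.smul_mem _ c H using 1
      rw [hs, map_smul, map_smul, smul_sub]
    rcases s with i | k | j
    · have hx : xVec n m i = Finsupp.single (x i) 1 := dif_pos i.2
      rw [← hx, torusCoord_xVec]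
      simpa using tailSpan_le_flag_left _ (yVec n m) 0
        (mem_tailSpan (e := xVec n m) (Nat.zero_le i))
    · rw [torusCoord_single_t]
      have : torusVec n m (Pi.single k 1) = Finsupp.single (t k) 1 := by
        simp [torusVec_apply, Pi.single_apply]
      rw [this, sub_self]
      exact zero_mem _
    · have hy : yVec n m j = Finsupp.single (y j) 1 := dif_pos j.2
      rw [← hy, torusCoord_yVec]
      simpa using tailSpan_le_flag_right (xVec n m) _ 0
        (mem_tailSpan (e := yVec n m) (Nat.zero_le j))

theorem ker_torusCoord : LinearMap.ker (torusCoord n m) = flag (xVec n m) (yVec n m) 0 := by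
  apply le_antisymm
  · intro v hv
    simpa [LinearMap.mem_ker.1 hv] using sub_torusVec_mem_flag v
  · exact flag_le.2 ⟨fun i _ => torusCoord_xVec i, fun i _ => torusCoord_yVec i⟩

theorem torusCoord_table (s u : SolvableIndex n m) : torusCoord n m (table s u) = 0 := by
  have hneg (v : SolvableIndex n m →₀ ℂ) (hv : torusCoord n m v = 0) :
      torusCoord n m (-v) = 0 := by
    rw [map_neg, hv, neg_zero]
  have hx (c : ℂ) (k : ℕ) : torusCoord n m (c • xVec n m k) = 0 := by
    rw [map_smul, torusCoord_xVec, smul_zero]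
  have hy (c : ℂ) (k : ℕ) : torusCoord n m (c • yVec n m k) = 0 := by
    rw [map_smul, torusCoord_yVec, smul_zero]
  rcases s with i | i | i <;> rcases u with j | j | j
  · rw [table]
    split_ifs
    exacts [torusCoord_xVec _, hneg _ (torusCoord_xVec _), map_zero _]
  · exact hneg _ (hx _ _)
  · rw [table]
    split_ifs
    exacts [torusCoord_yVec _, map_zero _]
  · exact hx _ _
  · exact map_zero _
  · exact hy _ _
  · rw [table]
    split_ifs
    exacts [hneg _ (torusCoord_yVec _), map_zero _]
  · exact hneg _ (hy _ _)
  · exact map_zero _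

theorem torusCoord_bracket (a b : SolvableIndex n m →₀ ℂ) :
    torusCoord n m ((solvableFiliform n m).bracket a b) = 0 := by
  change torusCoord n m (tableBracket table a b) = 0
  induction a using Finsupp.induction_linear with
  | zero => simp
  | add a a' h h' => rw [map_add, LinearMap.add_apply, map_add, h, h', add_zero]
  | single s c =>
    induction b using Finsupp.induction_linear with
    | zero => simp
    | add b b' h h' => rw [map_add, map_add, h, h', add_zero]
    | single u d =>
      have hs : Finsupp.single s c = c • (Finsupp.single s 1 : SolvableIndex n m →₀ ℂ) := by simp
      have hu : Finsupp.single u d = d • (Finsupp.single u 1 : SolvableIndex n m →₀ ℂ) := by simp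
      simp only [hs, hu, map_smul, LinearMap.smul_apply, tableBracket_single, torusCoord_table,
        smul_zero]

theorem square_solvableFiliform_le :
    (solvableFiliform n m).square ≤ LinearMap.ker (torusCoord n m) :=
  (commutator_le _).2 fun a _ b _ => torusCoord_bracket a b

theorem hasWeights_torusVec (c : Fin 3 → ℂ) :
    HasWeights (solvableFiliform n m) (xVec n m) (yVec n m) (torusVec n m c)
      (c 0) (2 * c 0 + c 1) (c 0 + c 2) := by
  have hbr : (solvableFiliform n m).bracket = tableBracket table := rfl
  have hx (i : ℕ) : (solvableFiliform n m).bracket (torusVec n m c) (xVec n m i)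
      = (∑ k, c k * xWeight k i) • xVec n m i := by
    simp only [torusVec_apply, hbr, map_sum, map_smul, LinearMap.sum_apply, LinearMap.smul_apply,
      bracket_t_x, Finset.sum_smul, mul_smul]
  have hy (i : ℕ) : (solvableFiliform n m).bracket (torusVec n m c) (yVec n m i)
      = (∑ k, c k * yWeight k i) • yVec n m i := by
    simp only [torusVec_apply, hbr, map_sum, map_smul, LinearMap.sum_apply, LinearMap.smul_apply,
      bracket_t_y, Finset.sum_smul, mul_smul]
  have hmem {S : Submodule ℂ (SolvableIndex n m →₀ ℂ)} {a b : SolvableIndex n m →₀ ℂ}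
      (hab : a = b) : a - b ∈ S := by
    rw [hab, sub_self]
    exact zero_mem _
  refine ⟨?_, hmem ?_, hmem ?_, hmem ?_⟩
  · rw [torusVec_apply]
    exact Submodule.sum_mem _ fun k _ =>
      Submodule.smul_mem _ _ (Finsupp.single_mem_supported _ _ rfl)
  · rw [hx, Fin.sum_univ_three]
    simp [xWeight]
  · rw [hx, Fin.sum_univ_three]
    simp only [xWeight, Matrix.cons_val, one_ne_zero, if_false]
    push_cast
    module
  · rw [hy, Fin.sum_univ_three]
    simp [yWeight]

theorem isIdeal_ker_torusCoord :
    (solvableFiliform n m).IsIdeal (LinearMap.ker (torusCoord n m)) := by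
  refine ⟨?_, fun a s _ => torusCoord_bracket a s⟩
  conv_lhs => rw [ker_torusCoord]
  exact flag_le.2 ⟨fun i _ => Submodule.mem_sup_left ⟨torusCoord_xVec i, xVec_mem i⟩,
    fun i _ => Submodule.mem_sup_right ⟨torusCoord_yVec i, yVec_mem i⟩⟩

/-- The nilradical of `SL^{n,m}` is the span of the `x i` and the `y j`: bracketing with an element
of a nilpotent ideal is a nilpotent operator, so its eigenvalues along the flag vanish, and these
determine its coordinates along `t 0`, `t 1`, `t 2`. -/
theorem isNilradical_ker_torusCoord (hn : 2 ≤ n) (hm : 1 ≤ m) :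
    (solvableFiliform n m).IsNilradical (LinearMap.ker (torusCoord n m)) := by
  have h := isFiliformFrame_solvableFiliform (m := m) hn
  refine ⟨isIdeal_ker_torusCoord, ker_torusCoord (n := n) (m := m) ▸ h.isNilpotent, ?_⟩
  intro I hI hnil v hv
  obtain ⟨K, hK⟩ := hI.exists_pow_bracket_eq_zero hnil hv
  set G := solvableFiliform n m with hG
  set c := torusCoord n m v with hc
  have hz := hasWeights_torusVec (n := n) (m := m) c
  set z := torusVec n m c
  have hu : v - z ∈ flag (xVec n m) (yVec n m) 0 := sub_torusVec_mem_flag v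
  set R := G.bracket.flip v with hR
  have hRe (e : SolvableIndex n m →₀ ℂ) : R e = -G.bracket z e + G.bracket e (v - z) := by
    rw [hR, LinearMap.flip_apply, G.bracket_swap_of_even hz.even, map_sub]
    abel
  have hRflag {k : ℕ} (s : SolvableIndex n m →₀ ℂ) (hs : s ∈ flag (xVec n m) (yVec n m) k) :
      R s ∈ flag (xVec n m) (yVec n m) k := by
    rw [hR, LinearMap.flip_apply, ← add_sub_cancel z v, map_add]
    exact add_mem (h.bracket_flag_even_mem hz hs)
      (flag_anti k.le_succ (h.bracket_flag_mem hs hu))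
  have hx (k : ℕ) (hk : k < n) : xVec n m k ∉ flag (xVec n m) (yVec n m) (k + 1) := by
    obtain ⟨f, hf, hfx, hfy⟩ := h.exists_dual_x hk
    intro hmem
    have : flag (xVec n m) (yVec n m) (k + 1) ≤ LinearMap.ker f :=
      flag_le.2 ⟨fun i hi => hfx i (by omega), fun i _ => hfy i⟩
    exact one_ne_zero (hf.symm.trans (this hmem))
  have hy : yVec n m 0 ∉ flag (xVec n m) (yVec n m) 1 := by
    obtain ⟨f, hf, hfx, hfy⟩ := h.exists_dual_y (k := 0) (by omega)
    intro hmem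
    have : flag (xVec n m) (yVec n m) 1 ≤ LinearMap.ker f :=
      flag_le.2 ⟨fun i _ => hfx i, fun i hi => hfy i (by omega)⟩
    exact one_ne_zero (hf.symm.trans (this hmem))
  have hev {k : ℕ} {e : SolvableIndex n m →₀ ℂ} {μ : ℂ}
      (he : e ∈ flag (xVec n m) (yVec n m) k) (he' : e ∉ flag (xVec n m) (yVec n m) (k + 1))
      (hμ : G.bracket z e - μ • e ∈ flag (xVec n m) (yVec n m) (k + 1)) : μ = 0 := by
    refine neg_eq_zero.1 (eigenvalue_eq_zero_of_pow_apply_eq_zero he' hRflag ?_ (hK e))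
    have := sub_mem (h.bracket_flag_mem he (h.flag_zero ▸ hu)) hμ
    convert this using 1
    rw [hRe]
    module
  have e₀ := hev (tailSpan_le_flag_left _ _ 0 (mem_tailSpan le_rfl)) (hx 0 (by omega))
    (tailSpan_le_flag_left _ _ 1 hz.x_zero)
  have e₁ := hev (tailSpan_le_flag_left _ _ 1 (mem_tailSpan le_rfl)) (hx 1 (by omega))
    (tailSpan_le_flag_left _ _ 2 hz.x_one)
  have e₂ := hev (tailSpan_le_flag_right _ _ 0 (mem_tailSpan le_rfl)) hy
    (tailSpan_le_flag_right _ _ 1 hz.y_zero)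
  rw [e₀, mul_zero, zero_add] at e₁
  rw [e₀, zero_add] at e₂
  rw [LinearMap.mem_ker, ← hc]
  funext i
  fin_cases i
  exacts [e₀, e₁, e₂]

theorem isSolvableWithFiliformNilradical_solvableFiliform (hn : 2 ≤ n) (hm : 1 ≤ m) :
    IsSolvableWithFiliformNilradical n m (solvableFiliform n m)
      (LinearMap.ker (torusCoord n m)) := by
  have h := isFiliformFrame_solvableFiliform (m := m) hn
  rw [← ker_torusCoord] at h
  have hsq : (solvableFiliform n m).IsNilpotent (solvableFiliform n m).square :=
    h.isNilpotent.mono square_solvableFiliform_le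
  exact ⟨isSolvable_of_isNilpotent_square hsq, hsq, isNilradical_ker_torusCoord hn hm,
    h.restrict_isIsomorphic hn _⟩

theorem rank_quotient_ker_torusCoord :
    Module.rank ℂ ((SolvableIndex n m →₀ ℂ) ⧸ LinearMap.ker (torusCoord n m)) = 3 := by
  have hsurj : Function.Surjective (torusCoord n m) := fun c => ⟨_, torusCoord_torusVec c⟩
  rw [((torusCoord n m).quotKerEquivOfSurjective hsurj).rank_eq, rank_fin_fun]
  norm_num

end Model

/-- The weight map embeds `V ⧸ N` into `ℂ³`, and it is onto when `V ⧸ N` has dimension `3`. -/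
theorem IsSolvableWithFiliformNilradical.rank_le_and_isIsomorphic {V : Type*} [AddCommGroup V]
    [Module ℂ V] {L : LieSuperalgebra V} {N : Submodule ℂ V} {n m : ℕ} (hn : 2 ≤ n) (hm : 1 ≤ m)
    (hL : IsSolvableWithFiliformNilradical n m L N) :
    Module.rank ℂ (V ⧸ N) ≤ 3 ∧
      (Module.rank ℂ (V ⧸ N) = 3 → L.IsIsomorphic (solvableFiliform n m)) := by
  have hN := hL.isNilradical
  have hsq := hN.square_le hL.square_isNilpotent
  obtain ⟨x₀, y, h₀⟩ := exists_isFiliformFrame hn hN.isIdeal hL.nilradical_iso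
  obtain ⟨x, h, hx⟩ := h₀.exists_adapted hn hm hsq
  obtain ⟨W, hker, hW⟩ := h.exists_weightMap hn hm hN hsq hx
  let W' : (V ⧸ N) →ₗ[ℂ] (Fin 3 → ℂ) := N.liftQ W hker.ge
  have hinj : Function.Injective W' := by
    rw [← LinearMap.ker_eq_bot, Submodule.ker_liftQ_eq_bot _ _ _ hker.le]
  have : Module.Finite ℂ (V ⧸ N) := Module.Finite.of_injective W' hinj
  constructor
  · have := LinearMap.finrank_le_finrank_of_injective hinj
    rw [Module.finrank_fin_fun] at this
    rw [← Module.finrank_eq_rank]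
    exact_mod_cast this
  · intro hrank
    have hfr : Module.finrank ℂ (V ⧸ N) = 3 := Module.finrank_eq_of_rank_eq (by simpa using hrank)
    refine h.isIsomorphic_of_weightMap_surjective hN hsq hker hW ?_
    have hsurj : Function.Surjective W' :=
      (LinearMap.injective_iff_surjective_of_finrank_eq_finrank (by simp [hfr])).1 hinj
    intro w
    obtain ⟨v, rfl⟩ := hsurj w
    obtain ⟨v, rfl⟩ := N.mkQ_surjective v
    exact ⟨v, rfl⟩

end LieSuperalgebra

theorem theorem3p1 (n m : ℕ) (hn : 2 ≤ n) (hm : 1 ≤ m) :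
    (∃ N : Submodule ℂ (LieSuperalgebra.SolvableIndex n m →₀ ℂ),
      LieSuperalgebra.IsSolvableWithFiliformNilradical n m
        (LieSuperalgebra.solvableFiliform n m) N ∧
      Module.rank ℂ ((LieSuperalgebra.SolvableIndex n m →₀ ℂ) ⧸ N) = 3) ∧
    ∀ (V : Type*) [AddCommGroup V] [Module ℂ V] (L : LieSuperalgebra V) (N : Submodule ℂ V),
      LieSuperalgebra.IsSolvableWithFiliformNilradical n m L N →
        Module.rank ℂ (V ⧸ N) ≤ 3 ∧
        (Module.rank ℂ (V ⧸ N) = 3 →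
          L.IsIsomorphic (LieSuperalgebra.solvableFiliform n m)) :=
  ⟨⟨_, LieSuperalgebra.isSolvableWithFiliformNilradical_solvableFiliform hn hm,
    LieSuperalgebra.rank_quotient_ker_torusCoord⟩, fun _ _ _ _ _ hL => hL.rank_le_and_isIsomorphic hn hm⟩
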